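/- Functions of $x$ are real-valued and $2\pi$-periodic unless stated otherwise; $(g,h)=\int_{-\pi}^{\pi} g\,\overline{h}\,dx$ and $\|\cdot\|$ denote the inner product and norm of $L^2=L^2[-\pi,\pi]$, $\hat g(k)=\frac1{2\pi}\int_{-\pi}^{\pi}e^{-ikx}g(x)\,dx$, and for an integer $r\ge 0$, $H^r$ is the space of $g\in L^2$ with $\|g\|_r^2=\sum_{k\in\mathbb Z}(1+k^2)^r|\hat g(k)|^2<\infty$. For an integer $N\ge 1$ let $S_N=\mathrm{span}_{\mathbb C}\{e^{ikx}: -N\le k\le N\}$ and let $P_N$ be the $L^2$-orthogonal projection onto $S_N$. The semi-discrete Fourier–Galerkin scheme with initial data $f$ asks for a differentiable map $U$ from $[0,\infty)$ to the real-valued elements of $S_N$ such that $$(U_t+UU_x+U_{xxx}-U_{xxxxx},\phi)=0\quad\text{for all }\phi\in S_N,\ t\ge 0,\qquad U(0)=P_Nf.$$ **Theorem.** (i) For every integer $N\ge1$ and every $f\in L^2$ the scheme has a unique solution $U$ on $[0,\infty)$. (ii) Let $r\ge 2$ be an integer, let $f\in H^r$, and let $u\in C([0,\infty);H^r)$ be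 a solution of the periodic Kawahara equation $$u_t+uu_x+u_{xxx}=u_{xxxxx},\qquad u(\cdot,0)=f,$$ with the spatial derivatives understood in the sense of distributions; that is, for every smooth $2\pi$-periodic $\varphi$ and every $t\ge0$, $\frac{d}{dt}\int_{-\pi}^{\pi}u\varphi\,dx=\int_{-\pi}^{\pi}\big(\tfrac12u^2\varphi_x+u\varphi_{xxx}-u\varphi_{xxxxx}\big)dx$ (one-sided derivative at $t=0$). Then for every $T>0$ there is a constant $C>0$, independent of $N$, such that for every integer $N\ge1$ the solution $U$ of the scheme with initial data $f$ satisfies $$\max_{0\le t\le T}\|u(t)-U(t)\|\le \frac{C}{N^{r}}.$$ -/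

import Mathlib

open scoped ContDiff Topology

noncomputable section

namespace Kawahara

/-- The `L²` inner product `(g, h) = ∫_{-π}^{π} g(x) conj(h(x)) dx`. -/
def l2Inner (g h : ℝ → ℂ) : ℂ :=
  ∫ x in (-Real.pi)..Real.pi, g x * (starRingEnd ℂ) (h x)

/-- The `L²` norm on `[-π, π]` of a real-valued function. -/
def l2Norm (g : ℝ → ℝ) : ℝ :=
  Real.sqrt (∫ x in (-Real.pi)..Real.pi, g x ^ 2)

/-- The Fourier coefficient `(1 / 2π) ∫_{-π}^{π} e^{-ikx} g(x) dx` of a real-valued function. -/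
def fourierCoef (g : ℝ → ℝ) (k : ℤ) : ℂ :=
  (1 / (2 * Real.pi) : ℂ) *
    ∫ x in (-Real.pi)..Real.pi, Complex.exp (-(Complex.I * k * x)) * (g x : ℂ)

/-- Real-valued `2π`-periodic functions that are square integrable on a period. -/
structure MemL2 (g : ℝ → ℝ) : Prop where
  periodic : Function.Periodic g (2 * Real.pi)
  memLp : MeasureTheory.MemLp g 2
    (MeasureTheory.volume.restrict (Set.Ioc (-Real.pi) Real.pi))

/-- The real-valued elements of the periodic Sobolev space `H^r`, for an integer `r ≥ 0`. -/
structure MemH (r : ℕ) (g : ℝ → ℝ) : Prop where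
  memL2 : MemL2 g
  summable : Summable fun k : ℤ => (1 + (k : ℝ) ^ 2) ^ r * ‖fourierCoef g k‖ ^ 2

/-- The norm of `H^r`, meaningful for `g` with `MemH r g`. -/
def hNorm (r : ℕ) (g : ℝ → ℝ) : ℝ :=
  Real.sqrt (∑' k : ℤ, (1 + (k : ℝ) ^ 2) ^ r * ‖fourierCoef g k‖ ^ 2)

/-- `S_N`, the complex span of the functions `e^{ikx}` with `-N ≤ k ≤ N`. -/
def trigSpace (N : ℕ) : Submodule ℂ (ℝ → ℂ) :=
  Submodule.span ℂ
    {e | ∃ k : ℤ, -(N : ℤ) ≤ k ∧ k ≤ N ∧ e = fun x : ℝ => Complex.exp (Complex.I * k * x)}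

/-- `g` is the `L²`-orthogonal projection `P_N f` of `f` onto `S_N`. -/
def IsProjection (N : ℕ) (f g : ℝ → ℝ) : Prop :=
  (fun x => (g x : ℂ)) ∈ trigSpace N ∧
    ∀ φ ∈ trigSpace N, l2Inner (fun x => ((f x - g x : ℝ) : ℂ)) φ = 0

/-- `U_t + U U_x + U_xxx - U_xxxxx` at time `t` and position `x`, for `U` written as `U t x`
and considered for times `t ≥ 0` (at `t = 0` the time derivative is one-sided). -/
def residual (U : ℝ → ℝ → ℝ) (t x : ℝ) : ℝ :=
  derivWithin (fun s => U s x) (Set.Ici 0) t + U t x * deriv (U t) x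
    + iteratedDeriv 3 (U t) x - iteratedDeriv 5 (U t) x

/-- `U` (restricted to times `t ≥ 0`) is a solution of the semi-discrete Fourier-Galerkin scheme
with initial data `f`: a differentiable map from `[0, ∞)` to the real-valued elements of `S_N`
with `(U_t + U U_x + U_xxx - U_xxxxx, φ) = 0` for all `φ ∈ S_N` and `t ≥ 0`,
and `U(0) = P_N f`. As `S_N` is finite-dimensional, differentiability in time amounts to
differentiability at every point `x`. -/
structure IsGalerkinSolution (N : ℕ) (f : ℝ → ℝ) (U : ℝ → ℝ → ℝ) : Prop where
  mem : ∀ t, 0 ≤ t → (fun x => (U t x : ℂ)) ∈ trigSpace N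
  differentiable : ∀ t, 0 ≤ t → ∀ x,
    DifferentiableWithinAt ℝ (fun s => U s x) (Set.Ici 0) t
  equation : ∀ t, 0 ≤ t → ∀ φ ∈ trigSpace N,
    l2Inner (fun x => (residual U t x : ℂ)) φ = 0
  initial : IsProjection N f (U 0)

/-- `u` (restricted to times `t ≥ 0`) is a solution in `C([0, ∞); H^r)` of the periodic Kawahara
equation `u_t + u u_x + u_xxx = u_xxxxx` with `u(·, 0) = f`. The spatial derivatives are taken in
the sense of periodic distributions: they are moved to smooth `2π`-periodic test functions. -/
structure IsKawaharaSolution (r : ℕ) (f : ℝ → ℝ) (u : ℝ → ℝ → ℝ) : Prop where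
  mem : ∀ t, 0 ≤ t → MemH r (u t)
  continuous : ∀ t, 0 ≤ t →
    Filter.Tendsto (fun s => hNorm r (fun x => u s x - u t x)) (𝓝[Set.Ici 0] t) (𝓝 0)
  equation : ∀ φ : ℝ → ℝ, ContDiff ℝ ∞ φ → Function.Periodic φ (2 * Real.pi) →
    ∀ t, 0 ≤ t →
      HasDerivWithinAt (fun s => ∫ x in (-Real.pi)..Real.pi, u s x * φ x)
        (∫ x in (-Real.pi)..Real.pi,
          (u t x ^ 2 / 2 * deriv φ x + u t x * iteratedDeriv 3 φ x
            - u t x * iteratedDeriv 5 φ x))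
        (Set.Ici 0) t
  initial : u 0 =ᵐ[MeasureTheory.volume] f

end Kawahara

end

open scoped ContDiff Topology ComplexConjugate

noncomputable section

namespace Kawahara

/-! On the Fourier side the Kawahara equation is u_k' = iω(k)u_k − (ik/2)(u∗u)_k with ω(k) = k³ +
k⁵, and the scheme is the same system truncated to |k| ≤ N. The dispersive part is skew and the
cubic sum coming from ∫θ²θ_x vanishes (`sum_conv_self_eq_zero`). Hence the truncated flow conserves
the L² norm, which gives global solutions and a bound on U uniform in N.

For the error, put θ = P_N u − U. The tail u − P_N u is O(N^{-r}) in L² because u stays bounded in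
H^r on [0,T]. In d/dt ‖θ‖² the transport of θ by P_N u costs only Σ(1+|k|)|û(k)|, by antisymmetry,
and in the tail–tail term the extra power of N gained by the ℓ¹ norm of the tail pays for the
derivative. The obstruction is ∂_x(P_N u · tail): there the derivative costs a factor N, and a
direct energy estimate would give only N^{1-r}.

This interaction is removed by a normal form. Frequencies a, m with |a+m| ≤ N < |m| have a ≠ 0, and
the phase ω(a)+ω(m)−ω(a+m) factors as −am(a+m)(3+5(a²+am+m²)). Its factor a+m cancels the
derivative, leaving the multiplier `nfCoef`, at most 1/(|a||m|³) in size (`nfCoef_mul_phase`,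
`abs_nfCoef_mul_le`). Subtracting the trilinear `normalForm` from ‖θ‖² cancels the bad term exactly
and leaves quartic terms. In these the decay of the multiplier, with |m| > N, absorbs the
derivatives and the factor N lost in bounding the ℓ¹ norm of U
(`errorEnergyRate_sub_normalFormRate_le`). The correction is itself O(N^{-r})‖θ‖, so the modified
energy controls ‖θ‖² up to O(N^{-2r}), and Grönwall's inequality concludes (`errorEnergy_le`). -/

/-! ### Convolutions on ℤ and Young's inequalities -/

/-- The convolution of two sequences indexed by `ℤ`. -/
def conv (a b : ℤ → ℂ) (k : ℤ) : ℂ := ∑' j, a j * b (k - j)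

theorem summable_mul_shift {x y : ℤ → ℝ} (hx : Summable x) (hx0 : ∀ k, 0 ≤ x k) {C : ℝ}
    (hy0 : ∀ k, 0 ≤ y k) (hy : ∀ k, y k ≤ C) (k : ℤ) : Summable fun j => x j * y (k - j) :=
  Summable.of_nonneg_of_le (fun j => mul_nonneg (hx0 j) (hy0 _))
    (fun j => mul_le_mul_of_nonneg_left (hy _) (hx0 j)) (hx.mul_right C)

theorem sum_shift_le {f : ℤ → ℝ} (hf : Summable f) (hf0 : ∀ k, 0 ≤ f k) {C : ℝ}
    (hC : ∑' k, f k ≤ C) (S : Finset ℤ) (j : ℤ) : ∑ k ∈ S, f (k - j) ≤ C := by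
  have hj : Summable fun k => f (k - j) := (Equiv.subRight j).summable_iff.mpr hf
  exact (hj.sum_le_tsum S fun k _ => hf0 _).trans
    (((Equiv.subRight j).tsum_eq f).trans_le hC)

/-- Young's inequality for nonnegative sequences: Cauchy–Schwarz with the weights x_j on the inner
sum, then an exchange of sums and shift invariance of the ℓ² norm. -/
theorem sum_sq_tsum_mul_shift_le {x y : ℤ → ℝ} (hx : Summable x) (hx0 : ∀ k, 0 ≤ x k)
    (hy0 : ∀ k, 0 ≤ y k) (hy : Summable fun k => y k ^ 2) {X Y : ℝ} (hX : ∑' k, x k ≤ X)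
    (hY : ∑' k, y k ^ 2 ≤ Y ^ 2) (S : Finset ℤ) :
    ∑ k ∈ S, (∑' j, x j * y (k - j)) ^ 2 ≤ (X * Y) ^ 2 := by
  have hX0 : 0 ≤ X := (tsum_nonneg hx0).trans hX
  have hyb : ∀ k, y k ≤ |Y| := fun k => by
    have h1 : y k ^ 2 ≤ Y ^ 2 := (hy.le_tsum k fun j _ => sq_nonneg _).trans hY
    exact (abs_of_nonneg (hy0 k)) ▸ sq_le_sq.mp h1
  have hs := fun k => summable_mul_shift hx hx0 hy0 hyb k
  -- Truncating the inner series to a finite set makes every exchange of sums finite; the bound is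
  -- uniform in the truncation and passes to the limit.
  have hlim : Filter.Tendsto (fun F : Finset ℤ => ∑ k ∈ S, (∑ j ∈ F, x j * y (k - j)) ^ 2)
      Filter.atTop (𝓝 (∑ k ∈ S, (∑' j, x j * y (k - j)) ^ 2)) :=
    tendsto_finsetSum _ fun k _ => ((hs k).hasSum).pow 2
  refine le_of_tendsto' hlim fun F => ?_
  have hF : ∑ j ∈ F, x j ≤ X := (hx.sum_le_tsum F fun j _ => hx0 j).trans hX
  have hF0 : 0 ≤ ∑ j ∈ F, x j := Finset.sum_nonneg fun j _ => hx0 j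
  have h1 : ∀ k, (∑ j ∈ F, x j * y (k - j)) ^ 2 ≤
      (∑ j ∈ F, x j) * ∑ j ∈ F, x j * y (k - j) ^ 2 := fun k =>
    Finset.sum_sq_le_sum_mul_sum_of_sq_le_mul F (fun j _ => hx0 j)
      (fun j _ => mul_nonneg (hx0 j) (sq_nonneg _)) (fun j _ => le_of_eq (by ring))
  have h2 : ∀ j, ∑ k ∈ S, y (k - j) ^ 2 ≤ Y ^ 2 :=
    sum_shift_le hy (fun _ => sq_nonneg _) hY S
  calc ∑ k ∈ S, (∑ j ∈ F, x j * y (k - j)) ^ 2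
      ≤ ∑ k ∈ S, (∑ j ∈ F, x j) * ∑ j ∈ F, x j * y (k - j) ^ 2 :=
        Finset.sum_le_sum fun k _ => h1 k
    _ = (∑ j ∈ F, x j) * ∑ j ∈ F, x j * ∑ k ∈ S, y (k - j) ^ 2 := by
        rw [← Finset.mul_sum, Finset.sum_comm]; simp_rw [Finset.mul_sum]
    _ ≤ (∑ j ∈ F, x j) * ∑ j ∈ F, x j * Y ^ 2 := by
        gcongr with j _
        · exact hx0 j
        · exact h2 j
    _ = (∑ j ∈ F, x j) ^ 2 * Y ^ 2 := by rw [← Finset.sum_mul]; ring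
    _ ≤ X ^ 2 * Y ^ 2 := by gcongr
    _ = (X * Y) ^ 2 := by ring

theorem norm_le_tsum_norm {a : ℤ → ℂ} (ha : Summable fun k => ‖a k‖) (k : ℤ) :
    ‖a k‖ ≤ ∑' j, ‖a j‖ := ha.le_tsum k fun _ _ => norm_nonneg _

theorem summable_norm_mul_shift {a b : ℤ → ℂ} (ha : Summable fun k => ‖a k‖) {C : ℝ}
    (hb : ∀ k, ‖b k‖ ≤ C) (k : ℤ) : Summable fun j => ‖a j‖ * ‖b (k - j)‖ :=
  summable_mul_shift ha (fun _ => norm_nonneg _) (fun _ => norm_nonneg _) hb k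

theorem summable_conv {a b : ℤ → ℂ} (ha : Summable fun k => ‖a k‖) {C : ℝ}
    (hb : ∀ k, ‖b k‖ ≤ C) (k : ℤ) : Summable fun j => a j * b (k - j) :=
  Summable.of_norm (by simpa only [norm_mul] using summable_norm_mul_shift ha hb k)

theorem norm_conv_le {a b : ℤ → ℂ} (ha : Summable fun k => ‖a k‖) {C : ℝ}
    (hb : ∀ k, ‖b k‖ ≤ C) (k : ℤ) : ‖conv a b k‖ ≤ ∑' j, ‖a j‖ * ‖b (k - j)‖ := by
  have h := summable_norm_mul_shift ha hb k
  refine (norm_tsum_le_tsum_norm (by simpa only [norm_mul] using h)).trans_eq ?_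
  simp only [norm_mul]

theorem norm_le_of_tsum_sq_le {b : ℤ → ℂ} (hb : Summable fun k => ‖b k‖ ^ 2) {Y : ℝ}
    (hY : ∑' k, ‖b k‖ ^ 2 ≤ Y ^ 2) (k : ℤ) : ‖b k‖ ≤ |Y| := by
  have h1 : ‖b k‖ ^ 2 ≤ Y ^ 2 := (hb.le_tsum k fun j _ => sq_nonneg _).trans hY
  exact (abs_of_nonneg (norm_nonneg (b k))) ▸ sq_le_sq.mp h1

/-- Young's inequality `ℓ¹ * ℓ² ⊆ ℓ²`. -/
theorem sum_sq_norm_conv_le {a b : ℤ → ℂ} (ha : Summable fun k => ‖a k‖)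
    (hb : Summable fun k => ‖b k‖ ^ 2) {X Y : ℝ} (hX : ∑' k, ‖a k‖ ≤ X)
    (hY : ∑' k, ‖b k‖ ^ 2 ≤ Y ^ 2) (S : Finset ℤ) :
    ∑ k ∈ S, ‖conv a b k‖ ^ 2 ≤ (X * Y) ^ 2 := by
  refine le_trans ?_ (sum_sq_tsum_mul_shift_le ha (fun _ => norm_nonneg _)
    (fun _ => norm_nonneg _) hb hX hY S)
  gcongr with k _
  exact norm_conv_le ha (norm_le_of_tsum_sq_le hb hY) k

/-- Young's inequality `ℓ¹ * ℓ¹ ⊆ ℓ¹`. -/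
theorem sum_norm_conv_le {a b : ℤ → ℂ} (ha : Summable fun k => ‖a k‖)
    (hb : Summable fun k => ‖b k‖) {X Y : ℝ} (hX : ∑' k, ‖a k‖ ≤ X)
    (hY : ∑' k, ‖b k‖ ≤ Y) (S : Finset ℤ) :
    ∑ k ∈ S, ‖conv a b k‖ ≤ X * Y := by
  have hs := fun k => summable_norm_mul_shift ha (norm_le_tsum_norm hb) k
  have hY0 : 0 ≤ Y := (tsum_nonneg fun _ => norm_nonneg _).trans hY
  calc ∑ k ∈ S, ‖conv a b k‖ ≤ ∑ k ∈ S, ∑' j, ‖a j‖ * ‖b (k - j)‖ :=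
        Finset.sum_le_sum fun k _ => norm_conv_le ha (norm_le_tsum_norm hb) k
    _ = ∑' j, ∑ k ∈ S, ‖a j‖ * ‖b (k - j)‖ := (Summable.tsum_finsetSum fun k _ => hs k).symm
    _ ≤ ∑' j, ‖a j‖ * Y := by
        refine Summable.tsum_le_tsum (fun j => ?_) (summable_sum fun k _ => hs k) (ha.mul_right Y)
        rw [← Finset.mul_sum]
        gcongr
        exact sum_shift_le hb (fun _ => norm_nonneg _) hY S j
    _ = (∑' j, ‖a j‖) * Y := tsum_mul_right
    _ ≤ X * Y := by gcongr

theorem conv_comm (a b : ℤ → ℂ) (k : ℤ) : conv a b k = conv b a k := by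
  unfold conv
  rw [← (Equiv.subLeft k).tsum_eq]
  simp [Equiv.subLeft_apply, mul_comm]

theorem conv_add_left {a b c : ℤ → ℂ} (ha : Summable fun k => ‖a k‖)
    (hb : Summable fun k => ‖b k‖) {C : ℝ} (hc : ∀ k, ‖c k‖ ≤ C) (k : ℤ) :
    conv (fun j => a j + b j) c k = conv a c k + conv b c k := by
  unfold conv
  rw [← (summable_conv ha hc k).tsum_add (summable_conv hb hc k)]
  simp only [add_mul]

theorem conv_sub_left {a b c : ℤ → ℂ} (ha : Summable fun k => ‖a k‖)
    (hb : Summable fun k => ‖b k‖) {C : ℝ} (hc : ∀ k, ‖c k‖ ≤ C) (k : ℤ) :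
    conv (fun j => a j - b j) c k = conv a c k - conv b c k := by
  unfold conv
  rw [← (summable_conv ha hc k).tsum_sub (summable_conv hb hc k)]
  simp only [sub_mul]

theorem conv_neg_index {a b : ℤ → ℂ} (ha : ∀ k, a (-k) = conj (a k))
    (hb : ∀ k, b (-k) = conj (b k)) (k : ℤ) : conv a b (-k) = conj (conv a b k) := by
  unfold conv
  rw [← (Equiv.neg ℤ).tsum_eq, Complex.conj_tsum]
  refine tsum_congr fun j => ?_
  rw [Equiv.neg_apply, ha, show -k - -j = -(k - j) by ring, hb, map_mul]

/-! ### Bilinear and trilinear estimates -/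

theorem abs_re_sum_mul_le {S : Finset ℤ} {c g z : ℤ → ℂ} {G Z : ℝ} (hG : 0 ≤ G) (hZ : 0 ≤ Z)
    (hc : ∀ k ∈ S, ‖c k‖ ≤ 1) (hg : ∑ k ∈ S, ‖g k‖ ^ 2 ≤ G ^ 2)
    (hz : ∑ k ∈ S, ‖z k‖ ^ 2 ≤ Z ^ 2) :
    |(∑ k ∈ S, c k * g k * z k).re| ≤ G * Z := by
  refine (Complex.abs_re_le_norm _).trans ((norm_sum_le _ _).trans ?_)
  calc ∑ k ∈ S, ‖c k * g k * z k‖ ≤ ∑ k ∈ S, ‖g k‖ * ‖z k‖ := by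
        refine Finset.sum_le_sum fun k hk => ?_
        rw [norm_mul, norm_mul]
        have := mul_le_mul_of_nonneg_right (hc k hk) (norm_nonneg (g k))
        rw [one_mul] at this
        gcongr
    _ ≤ √(∑ k ∈ S, ‖g k‖ ^ 2) * √(∑ k ∈ S, ‖z k‖ ^ 2) :=
        Real.sum_mul_le_sqrt_mul_sqrt _ _ _
    _ ≤ G * Z := by
        gcongr
        · exact Real.sqrt_le_iff.mpr ⟨hG, hg⟩
        · exact Real.sqrt_le_iff.mpr ⟨hZ, hz⟩

/-- The trilinear estimate `|∑ c x_a y_{k-a} z_k| ≤ ‖x‖_{ℓ¹} ‖y‖_{ℓ²} ‖z‖_{ℓ²}`. -/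
theorem abs_sum_trilinear_le {S I : Finset ℤ} {c : ℤ → ℤ → ℝ} {x y z : ℤ → ℂ} {X Y Z : ℝ}
    (hY0 : 0 ≤ Y) (hZ0 : 0 ≤ Z) {p : ℤ → ℤ → ℂ}
    (hp : ∀ k ∈ S, ∀ a ∈ I, ‖p k a‖ * |c k a| ≤ ‖x a‖ * ‖y (k - a)‖ * ‖z k‖)
    (hx : ∑ a ∈ I, ‖x a‖ ≤ X) (hy : Summable fun k => ‖y k‖ ^ 2)
    (hY : ∑' k, ‖y k‖ ^ 2 ≤ Y ^ 2) (hz : ∑ k ∈ S, ‖z k‖ ^ 2 ≤ Z ^ 2) :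
    |∑ k ∈ S, ∑ a ∈ I, c k a * (p k a).re| ≤ X * Y * Z := by
  calc |∑ k ∈ S, ∑ a ∈ I, c k a * (p k a).re|
      ≤ ∑ k ∈ S, ∑ a ∈ I, ‖x a‖ * ‖y (k - a)‖ * ‖z k‖ := by
        refine (Finset.abs_sum_le_sum_abs _ _).trans (Finset.sum_le_sum fun k hk => ?_)
        refine (Finset.abs_sum_le_sum_abs _ _).trans (Finset.sum_le_sum fun a ha => ?_)
        refine le_trans ?_ (hp k hk a ha)
        rw [abs_mul, mul_comm]
        gcongr
        exact Complex.abs_re_le_norm _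
    _ = ∑ a ∈ I, ‖x a‖ * ∑ k ∈ S, ‖y (k - a)‖ * ‖z k‖ := by
        rw [Finset.sum_comm]; simp_rw [Finset.mul_sum, mul_assoc]
    _ ≤ ∑ a ∈ I, ‖x a‖ * (Y * Z) := by
        gcongr with a _
        refine (Real.sum_mul_le_sqrt_mul_sqrt _ _ _).trans ?_
        have h2 : ∑ k ∈ S, ‖y (k - a)‖ ^ 2 ≤ Y ^ 2 :=
          sum_shift_le hy (fun _ => sq_nonneg _) hY S a
        gcongr
        · exact Real.sqrt_le_iff.mpr ⟨hY0, h2⟩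
        · exact Real.sqrt_le_iff.mpr ⟨hZ0, hz⟩
    _ ≤ X * Y * Z := by
        rw [← Finset.sum_mul, mul_assoc]
        gcongr

/-! ### Transport identities for trigonometric polynomials -/

theorem not_mem_Icc_iff {N : ℕ} {k : ℤ} : k ∉ Finset.Icc (-(N : ℤ)) N ↔ (N : ℤ) < |k| := by
  rw [Finset.mem_Icc, ← abs_le, not_le]

theorem neg_mem_Icc_iff {N : ℕ} {k : ℤ} :
    -k ∈ Finset.Icc (-(N : ℤ)) N ↔ k ∈ Finset.Icc (-(N : ℤ)) N := by
  rw [Finset.mem_Icc, Finset.mem_Icc]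
  constructor <;> intro h <;> constructor <;> linarith [h.1, h.2]

theorem sum_Icc_neg {M : Type*} [AddCommMonoid M] (N : ℕ) (f : ℤ → M) :
    ∑ k ∈ Finset.Icc (-(N : ℤ)) N, f (-k) = ∑ k ∈ Finset.Icc (-(N : ℤ)) N, f k :=
  Finset.sum_equiv (Equiv.neg ℤ) (fun _ => neg_mem_Icc_iff.symm) (fun _ _ => rfl)

theorem hasSum_of_support {N : ℕ} {θ : ℤ → ℂ} (hθ : ∀ k : ℤ, (N : ℤ) < |k| → θ k = 0)
    {f : ℂ → ℝ} (hf : f 0 = 0) :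
    HasSum (fun k => f (θ k)) (∑ k ∈ Finset.Icc (-(N : ℤ)) N, f (θ k)) :=
  hasSum_sum_of_ne_finset_zero fun k hk => by rw [hθ k (not_mem_Icc_iff.mp hk), hf]

/-- The substitution k ↦ a − k exchanges the two factors θ, so k may be replaced by the average a/2
of k and a − k. This is integration by parts: the derivative leaves θ and falls on the function of
frequency a. -/
theorem sum_mul_shift_eq {N : ℕ} {θ : ℤ → ℂ} (hθ : ∀ k : ℤ, (N : ℤ) < |k| → θ k = 0)
    (a : ℤ) :
    ∑ k ∈ Finset.Icc (-(N : ℤ)) N, (k : ℂ) * θ (k - a) * θ (-k) =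
      a / 2 * ∑ k ∈ Finset.Icc (-(N : ℤ)) N, θ (k - a) * θ (-k) := by
  have h0 : ∀ k : ℤ, k ∉ Finset.Icc (-(N : ℤ)) N → θ (-k) = 0 := fun k hk =>
    hθ _ (by rw [abs_neg]; exact not_mem_Icc_iff.mp hk)
  have h1 : Summable fun k : ℤ => (k : ℂ) * θ (k - a) * θ (-k) :=
    summable_of_ne_finset_zero (s := Finset.Icc (-(N : ℤ)) N) fun k hk => by simp [h0 k hk]
  have h2 : Summable fun k : ℤ => θ (k - a) * θ (-k) :=
    summable_of_ne_finset_zero (s := Finset.Icc (-(N : ℤ)) N) fun k hk => by simp [h0 k hk]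
  -- The window |k| ≤ N is not invariant under k ↦ a − k. The sums are therefore extended to all of
  -- ℤ, where the support of θ makes the extra terms vanish.
  have e1 : ∑' k : ℤ, (k : ℂ) * θ (k - a) * θ (-k) =
      ∑ k ∈ Finset.Icc (-(N : ℤ)) N, (k : ℂ) * θ (k - a) * θ (-k) :=
    tsum_eq_sum fun k hk => by simp [h0 k hk]
  have e2 : ∑' k : ℤ, θ (k - a) * θ (-k) =
      ∑ k ∈ Finset.Icc (-(N : ℤ)) N, θ (k - a) * θ (-k) :=
    tsum_eq_sum fun k hk => by simp [h0 k hk]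
  rw [← e1, ← e2]
  have h3 : ∑' k : ℤ, (k : ℂ) * θ (k - a) * θ (-k) =
      ∑' k : ℤ, (a * (θ (k - a) * θ (-k)) - (k : ℂ) * θ (k - a) * θ (-k)) := by
    rw [← (Equiv.subLeft a).tsum_eq]
    refine tsum_congr fun k => ?_
    rw [Equiv.subLeft_apply, show a - k - a = -k by ring, show -(a - k) = k - a by ring]
    push_cast; ring
  rw [(h2.mul_left (a : ℂ)).tsum_sub h1, tsum_mul_left] at h3
  linear_combination h3 / 2

theorem sum_mul_conv_eq {N : ℕ} {θ : ℤ → ℂ} (hθ : ∀ k : ℤ, (N : ℤ) < |k| → θ k = 0)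
    (hs : ∀ k, θ (-k) = conj (θ k)) {w : ℤ → ℂ} (hw : Summable fun k => ‖w k‖) :
    ∑ k ∈ Finset.Icc (-(N : ℤ)) N, -(Complex.I * k) * conv w θ k * conj (θ k) =
      ∑' a, -(Complex.I * w a * (a / 2 * ∑ k ∈ Finset.Icc (-(N : ℤ)) N, θ (k - a) * θ (-k))) := by
  have hb : ∀ k, ‖θ k‖ ≤ ∑' j, ‖θ j‖ :=
    norm_le_tsum_norm (hasSum_of_support hθ (f := norm) norm_zero).summable
  calc _ = ∑ k ∈ Finset.Icc (-(N : ℤ)) N,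
        ∑' a, -(Complex.I * k * conj (θ k)) * (w a * θ (k - a)) := by
        refine Finset.sum_congr rfl fun k _ => ?_
        rw [tsum_mul_left, conv]; ring
    _ = ∑' a, ∑ k ∈ Finset.Icc (-(N : ℤ)) N,
          -(Complex.I * k * conj (θ k)) * (w a * θ (k - a)) :=
        (Summable.tsum_finsetSum fun k _ => (summable_conv hw hb k).mul_left _).symm
    _ = _ := by
        refine tsum_congr fun a => ?_
        rw [← sum_mul_shift_eq hθ a, Finset.mul_sum, ← Finset.sum_neg_distrib]
        refine Finset.sum_congr rfl fun k _ => ?_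
        rw [hs]; ring

/-- The transport term `∫ w θ θ_x` is controlled by `‖w_x‖ ‖θ‖²`. -/
theorem abs_re_sum_conv_le {N : ℕ} {θ : ℤ → ℂ} (hθ : ∀ k : ℤ, (N : ℤ) < |k| → θ k = 0)
    (hs : ∀ k, θ (-k) = conj (θ k)) {w : ℤ → ℂ} (hw : Summable fun k : ℤ => (1 + |(k : ℝ)|) * ‖w k‖)
    {A : ℝ} (hA : ∑' k : ℤ, (1 + |(k : ℝ)|) * ‖w k‖ ≤ A) :
    |(∑ k ∈ Finset.Icc (-(N : ℤ)) N, -(Complex.I * k) * conv w θ k * conj (θ k)).re| ≤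
      A / 2 * ∑ k ∈ Finset.Icc (-(N : ℤ)) N, ‖θ k‖ ^ 2 := by
  set E := ∑ k ∈ Finset.Icc (-(N : ℤ)) N, ‖θ k‖ ^ 2 with hE
  have hE0 : 0 ≤ E := Finset.sum_nonneg fun _ _ => sq_nonneg _
  have hw1 : Summable fun k => ‖w k‖ :=
    Summable.of_nonneg_of_le (fun _ => norm_nonneg _)
      (fun k => le_mul_of_one_le_left (norm_nonneg _) (by linarith [abs_nonneg (k : ℝ)])) hw
  rw [sum_mul_conv_eq hθ hs hw1]
  have hsq := hasSum_of_support hθ (f := fun z => ‖z‖ ^ 2) (by simp)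
  -- Cauchy–Schwarz: each autocorrelation of θ is at most its energy, whatever the shift a.
  have hH : ∀ a : ℤ, ‖∑ k ∈ Finset.Icc (-(N : ℤ)) N, θ (k - a) * θ (-k)‖ ≤ E := fun a => by
    refine (norm_sum_le _ _).trans ?_
    simp only [norm_mul]
    refine (Real.sum_mul_le_sqrt_mul_sqrt _ _ _).trans ?_
    have h1 : ∑ k ∈ Finset.Icc (-(N : ℤ)) N, ‖θ (k - a)‖ ^ 2 ≤ E :=
      sum_shift_le hsq.summable (fun _ => sq_nonneg _) hsq.tsum_eq.le _ a
    have h2 : ∑ k ∈ Finset.Icc (-(N : ℤ)) N, ‖θ (-k)‖ ^ 2 = E :=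
      sum_Icc_neg N (fun k => ‖θ k‖ ^ 2)
    rw [h2]
    calc _ ≤ √E * √E := by gcongr
      _ = E := Real.mul_self_sqrt hE0
  have hle : ∀ a : ℤ, ‖-(Complex.I * w a * (a / 2 *
      ∑ k ∈ Finset.Icc (-(N : ℤ)) N, θ (k - a) * θ (-k)))‖ ≤
      (1 + |(a : ℝ)|) * ‖w a‖ * (E / 2) := fun a => by
    rw [norm_neg, norm_mul, norm_mul, norm_mul, Complex.norm_I, norm_div, Complex.norm_intCast,
      Complex.norm_ofNat]
    calc _ ≤ 1 * ‖w a‖ * (|(a : ℝ)| / 2 * E) := by gcongr; exact hH a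
      _ ≤ _ := by
        have := mul_nonneg (norm_nonneg (w a)) hE0
        nlinarith
  refine (Complex.abs_re_le_norm _).trans ?_
  refine (tsum_of_norm_bounded (hw.mul_right (E / 2)).hasSum hle).trans ?_
  rw [tsum_mul_right]
  nlinarith

/-- The cubic term `∫ θ² θ_x` vanishes. -/
theorem sum_conv_self_eq_zero {N : ℕ} {θ : ℤ → ℂ} (hθ : ∀ k : ℤ, (N : ℤ) < |k| → θ k = 0)
    (hs : ∀ k, θ (-k) = conj (θ k)) :
    ∑ k ∈ Finset.Icc (-(N : ℤ)) N, -(Complex.I * k) * conv θ θ k * conj (θ k) = 0 := by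
  have h1 := hasSum_of_support hθ (f := norm) norm_zero
  have hc : ∀ k, conv θ θ k = ∑ a ∈ Finset.Icc (-(N : ℤ)) N, θ a * θ (k - a) := fun k =>
    tsum_eq_sum fun a ha => by rw [hθ a (not_mem_Icc_iff.mp ha), zero_mul]
  have h2 := sum_mul_conv_eq hθ hs h1.summable
  rw [tsum_eq_sum (s := Finset.Icc (-(N : ℤ)) N)
    fun a ha => by rw [hθ a (not_mem_Icc_iff.mp ha)]; ring] at h2
  -- Reflecting both indices turns the inner sum into the convolution at a and makes a the tested
  -- frequency. The integrated-by-parts sum is thus −1/2 times the original one, which forces the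
  -- original to be zero.
  have h3 : ∑ a ∈ Finset.Icc (-(N : ℤ)) N, -(Complex.I * θ a * (a / 2 *
      ∑ k ∈ Finset.Icc (-(N : ℤ)) N, θ (k - a) * θ (-k))) =
      -(1 / 2) * ∑ k ∈ Finset.Icc (-(N : ℤ)) N,
        -(Complex.I * k) * conv θ θ k * conj (θ k) := by
    calc _ = ∑ a ∈ Finset.Icc (-(N : ℤ)) N, ∑ k ∈ Finset.Icc (-(N : ℤ)) N,
          -(Complex.I * a / 2 * (θ a * θ (k - a) * θ (-k))) := by
          refine Finset.sum_congr rfl fun a _ => ?_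
          rw [Finset.mul_sum, Finset.mul_sum, ← Finset.sum_neg_distrib]
          exact Finset.sum_congr rfl fun k _ => by ring
      _ = ∑ a ∈ Finset.Icc (-(N : ℤ)) N, ∑ k ∈ Finset.Icc (-(N : ℤ)) N,
          (Complex.I * a / 2 * (θ (-a) * θ (a - k) * θ k)) := by
          rw [← sum_Icc_neg]
          refine Finset.sum_congr rfl fun a _ => ?_
          rw [← sum_Icc_neg]
          refine Finset.sum_congr rfl fun k _ => ?_
          rw [show -k - -a = a - k by ring, neg_neg]; push_cast; ring
      _ = _ := by
          rw [Finset.mul_sum]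
          refine Finset.sum_congr rfl fun a _ => ?_
          rw [hc, Finset.mul_sum, Finset.sum_mul, Finset.mul_sum]
          refine Finset.sum_congr rfl fun k _ => ?_
          rw [hs]; ring
  rw [h3] at h2
  linear_combination (2 / 3) * h2

/-! ### The Kawahara system in Fourier variables -/

/-- The dispersion relation of the Kawahara equation. -/
def omega (k : ℤ) : ℝ := (k : ℝ) ^ 3 + (k : ℝ) ^ 5

/-- The Kawahara equation for Fourier coefficients reads `u_k' = kawaharaRhs u k`. -/
def kawaharaRhs (u : ℤ → ℂ) (k : ℤ) : ℂ :=
  Complex.I * omega k * u k - Complex.I * k / 2 * conv u u k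

/-- The part of a sequence at frequencies above `N`. -/
def tail (N : ℕ) (u : ℤ → ℂ) (k : ℤ) : ℂ := if (N : ℤ) < |k| then u k else 0

/-- The part of a sequence at frequencies up to `N`. -/
def head (N : ℕ) (u : ℤ → ℂ) (k : ℤ) : ℂ := if (N : ℤ) < |k| then 0 else u k

/-- The multiplier of the normal form transformation. -/
def nfCoef (a m : ℤ) : ℝ := 2 / (a * m * (3 + 5 * ((a : ℝ) ^ 2 + a * m + (m : ℝ) ^ 2)))

/-- A real sequence in `H^r` with bounds on its norms. -/
structure SobolevBound (r : ℕ) (A M : ℝ) (u : ℤ → ℂ) : Prop where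
  conj_symm : ∀ k, u (-k) = conj (u k)
  summable_one : Summable fun k : ℤ => (1 + |(k : ℝ)|) * ‖u k‖
  one_le : ∑' k : ℤ, (1 + |(k : ℝ)|) * ‖u k‖ ≤ A
  summable_sq : Summable fun k : ℤ => (1 + (k : ℝ) ^ 2) ^ r * ‖u k‖ ^ 2
  sq_le : ∑' k : ℤ, (1 + (k : ℝ) ^ 2) ^ r * ‖u k‖ ^ 2 ≤ M ^ 2

/-- The coefficients of a real trigonometric polynomial of degree `N` with an `L²` bound. -/
structure TrigBound (N : ℕ) (M : ℝ) (v : ℤ → ℂ) : Prop where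
  conj_symm : ∀ k, v (-k) = conj (v k)
  support : ∀ k : ℤ, (N : ℤ) < |k| → v k = 0
  sq_le : ∑ k ∈ Finset.Icc (-(N : ℤ)) N, ‖v k‖ ^ 2 ≤ M ^ 2

theorem head_add_tail (N : ℕ) (u : ℤ → ℂ) (k : ℤ) : head N u k + tail N u k = u k := by
  unfold head tail; split_ifs <;> simp

theorem head_of_mem {N : ℕ} (u : ℤ → ℂ) {k : ℤ} (hk : k ∈ Finset.Icc (-(N : ℤ)) N) :
    head N u k = u k := if_neg fun h => not_mem_Icc_iff.mpr h hk

theorem norm_head_le (N : ℕ) (u : ℤ → ℂ) (k : ℤ) : ‖head N u k‖ ≤ ‖u k‖ := by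
  unfold head; split_ifs <;> simp

/-! ### The resonance function and the size of the multiplier -/

theorem two_mul_sq_le_resonance (a m : ℤ) :
    2 * (m : ℝ) ^ 2 ≤ 3 + 5 * ((a : ℝ) ^ 2 + a * m + (m : ℝ) ^ 2) := by
  nlinarith [sq_nonneg ((a : ℝ) + m / 2), sq_nonneg (m : ℝ)]

theorem resonance_pos (a m : ℤ) : 0 < 3 + 5 * ((a : ℝ) ^ 2 + a * m + (m : ℝ) ^ 2) := by
  nlinarith [sq_nonneg ((a : ℝ) + m / 2), sq_nonneg (m : ℝ)]

/-- Both (a+m)³ − a³ − m³ = 3am(a+m) and (a+m)⁵ − a⁵ − m⁵ = 5am(a+m)(a²+am+m²) contain the factor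
am(a+m). Since a + m is never divided by, the case a + m = 0 needs no exclusion. -/
theorem nfCoef_mul_phase {a m : ℤ} (ha : a ≠ 0) (hm : m ≠ 0) :
    nfCoef a m * (omega a + omega m - omega (a + m)) = -2 * (a + m) := by
  have h := (resonance_pos a m).ne'
  have ha' : (a : ℝ) ≠ 0 := Int.cast_ne_zero.mpr ha
  have hm' : (m : ℝ) ≠ 0 := Int.cast_ne_zero.mpr hm
  unfold nfCoef omega
  rw [div_mul_eq_mul_div, div_eq_iff (by positivity)]
  push_cast
  ring

/-- The quadratic form in the denominator dominates 2m², and this 2 cancels the numerator of the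
multiplier. For a = 0 or m = 0 the product on the left is zero. -/
theorem abs_nfCoef_mul_le (a m : ℤ) : |nfCoef a m| * (|(a : ℝ)| * |(m : ℝ)| ^ 3) ≤ 1 := by
  by_cases ha : a = 0
  · simp [ha]
  by_cases hm : m = 0
  · simp [hm]
  have ha' : 0 < |(a : ℝ)| := abs_pos.mpr (Int.cast_ne_zero.mpr ha)
  have hm' : 0 < |(m : ℝ)| := abs_pos.mpr (Int.cast_ne_zero.mpr hm)
  unfold nfCoef
  rw [abs_div, abs_mul, abs_mul, abs_of_pos (resonance_pos a m), abs_two, div_mul_eq_mul_div,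
    div_le_one (by have := resonance_pos a m; positivity)]
  calc 2 * (|(a : ℝ)| * |(m : ℝ)| ^ 3) = |(a : ℝ)| * |(m : ℝ)| * (2 * (m : ℝ) ^ 2) := by
        rw [← sq_abs (m : ℝ)]; ring
    _ ≤ _ := by gcongr; exact two_mul_sq_le_resonance a m

theorem nfCoef_zero_left (m : ℤ) : nfCoef 0 m = 0 := by simp [nfCoef]

theorem one_le_abs_cast {a : ℤ} (ha : a ≠ 0) : (1 : ℝ) ≤ |(a : ℝ)| := by
  exact_mod_cast Int.one_le_abs ha

theorem abs_nfCoef_mul_cube_le (a m : ℤ) : |nfCoef a m| * |(m : ℝ)| ^ 3 ≤ 1 := by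
  by_cases ha : a = 0
  · simp [ha, nfCoef_zero_left]
  refine le_trans ?_ (abs_nfCoef_mul_le a m)
  gcongr
  exact le_mul_of_one_le_left (by positivity) (one_le_abs_cast ha)

theorem abs_nfCoef_mul_abs_left_le (a : ℤ) {m : ℤ} (hm : m ≠ 0) :
    |nfCoef a m| * |(a : ℝ)| ≤ 1 := by
  refine le_trans ?_ (abs_nfCoef_mul_le a m)
  gcongr
  exact le_mul_of_one_le_right (by positivity) (one_le_pow₀ (one_le_abs_cast hm))

theorem abs_nfCoef_mul_abs_right_le (a : ℤ) {m : ℤ} (hm : m ≠ 0) :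
    |nfCoef a m| * |(m : ℝ)| ≤ 1 := by
  refine le_trans ?_ (abs_nfCoef_mul_cube_le a m)
  gcongr
  exact le_self_pow₀ (one_le_abs_cast hm) (by norm_num)

theorem abs_nfCoef_le_one (a : ℤ) {m : ℤ} (hm : m ≠ 0) : |nfCoef a m| ≤ 1 := by
  refine le_trans ?_ (abs_nfCoef_mul_cube_le a m)
  exact le_mul_of_one_le_right (by positivity) (one_le_pow₀ (one_le_abs_cast hm))

theorem ne_zero_of_lt_abs {N : ℕ} {m : ℤ} (h : (N : ℤ) < |m|) : m ≠ 0 := by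
  rintro rfl; simp at h; omega

theorem cast_le_abs_cast {N : ℕ} {m : ℤ} (h : (N : ℤ) < |m|) : (N : ℝ) ≤ |(m : ℝ)| := by
  exact_mod_cast h.le

/-! ### Sobolev tails and the algebra property -/

theorem pow_le_sobolev_weight (r : ℕ) (k : ℤ) : (|(k : ℝ)| ^ r) ^ 2 ≤ (1 + (k : ℝ) ^ 2) ^ r := by
  rw [← pow_mul, mul_comm, pow_mul, sq_abs]
  gcongr
  linarith

theorem SobolevBound.summable_norm {r : ℕ} {A M : ℝ} {u : ℤ → ℂ} (hu : SobolevBound r A M u) :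
    Summable fun k => ‖u k‖ :=
  Summable.of_nonneg_of_le (fun _ => norm_nonneg _)
    (fun k => le_mul_of_one_le_left (norm_nonneg _) (by linarith [abs_nonneg (k : ℝ)]))
    hu.summable_one

theorem SobolevBound.tsum_norm_le {r : ℕ} {A M : ℝ} {u : ℤ → ℂ} (hu : SobolevBound r A M u) :
    ∑' k, ‖u k‖ ≤ A :=
  (Summable.tsum_le_tsum
    (fun k => le_mul_of_one_le_left (norm_nonneg _) (by linarith [abs_nonneg (k : ℝ)]))
    hu.summable_norm hu.summable_one).trans hu.one_le

/-- A sequence whose weighted `ℓ²` norm is finite has a tail of size `N^{-r}`. -/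
theorem tail_sq_le {N : ℕ} (hN : 1 ≤ N) {r : ℕ} {g : ℤ → ℂ} {G : ℝ}
    (hg : Summable fun k : ℤ => (|(k : ℝ)| ^ r * ‖g k‖) ^ 2)
    (hG : ∑' k : ℤ, (|(k : ℝ)| ^ r * ‖g k‖) ^ 2 ≤ G ^ 2) :
    (Summable fun k => ‖tail N g k‖ ^ 2) ∧
      ∑' k, ‖tail N g k‖ ^ 2 ≤ (G * ((N : ℝ) ^ r)⁻¹) ^ 2 := by
  have hN0 : (0 : ℝ) < (N : ℝ) ^ r := by positivity
  have hle : ∀ k, ‖tail N g k‖ ^ 2 ≤ (|(k : ℝ)| ^ r * ‖g k‖) ^ 2 * (((N : ℝ) ^ r)⁻¹) ^ 2 := by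
    intro k
    rw [← mul_pow]
    refine pow_le_pow_left₀ (norm_nonneg _) ?_ 2
    unfold tail
    split_ifs with h
    · rw [mul_comm (|(k : ℝ)| ^ r), mul_assoc]
      refine le_mul_of_one_le_right (norm_nonneg _) ?_
      rw [← div_eq_mul_inv, one_le_div hN0]
      exact pow_le_pow_left₀ (by positivity) (cast_le_abs_cast h) r
    · rw [norm_zero]; positivity
  have hs := hg.mul_right ((((N : ℝ) ^ r)⁻¹) ^ 2)
  have hs' := Summable.of_nonneg_of_le (fun _ => sq_nonneg _) hle hs
  refine ⟨hs', (hs'.tsum_le_tsum hle hs).trans ?_⟩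
  rw [tsum_mul_right, mul_pow]
  gcongr

theorem SobolevBound.summable_pow_sq {r : ℕ} {A M : ℝ} {u : ℤ → ℂ} (hu : SobolevBound r A M u) :
    Summable fun k : ℤ => (|(k : ℝ)| ^ r * ‖u k‖) ^ 2 :=
  Summable.of_nonneg_of_le (fun _ => sq_nonneg _) (fun k => by
    rw [mul_pow]
    exact mul_le_mul_of_nonneg_right (pow_le_sobolev_weight r k) (sq_nonneg _)) hu.summable_sq

theorem SobolevBound.tsum_pow_sq_le {r : ℕ} {A M : ℝ} {u : ℤ → ℂ} (hu : SobolevBound r A M u) :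
    ∑' k : ℤ, (|(k : ℝ)| ^ r * ‖u k‖) ^ 2 ≤ M ^ 2 :=
  (hu.summable_pow_sq.tsum_le_tsum (fun k => by
    rw [mul_pow]
    exact mul_le_mul_of_nonneg_right (pow_le_sobolev_weight r k) (sq_nonneg _))
    hu.summable_sq).trans hu.sq_le

/-- `H^r` is an algebra. -/
theorem SobolevBound.sum_conv_sq_le {r : ℕ} {A M : ℝ} {u : ℤ → ℂ} (hu : SobolevBound r A M u)
    (S : Finset ℤ) :
    ∑ k ∈ S, (|(k : ℝ)| ^ r * ‖conv u u k‖) ^ 2 ≤ (2 ^ (r - 1) * 2 * (A * M)) ^ 2 := by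
  have hyb : ∀ k : ℤ, |(k : ℝ)| ^ r * ‖u k‖ ≤ |M| := fun k => by
    have h1 := (hu.summable_pow_sq.le_tsum k fun j _ => sq_nonneg _).trans hu.tsum_pow_sq_le
    exact (abs_of_nonneg (by positivity : 0 ≤ |(k : ℝ)| ^ r * ‖u k‖)) ▸ sq_le_sq.mp h1
  have hs := summable_mul_shift hu.summable_norm (fun _ => norm_nonneg _)
    (fun k => (by positivity : 0 ≤ |(k : ℝ)| ^ r * ‖u k‖)) hyb
  have hs2 : ∀ k : ℤ, Summable fun j : ℤ => |(j : ℝ)| ^ r * ‖u j‖ * ‖u (k - j)‖ := fun k => by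
    have := (Equiv.subLeft k).summable_iff.mpr (hs k)
    refine this.congr fun j => ?_
    simp only [Function.comp_apply, Equiv.subLeft_apply, sub_sub_cancel]
    ring
  have heq : ∀ k : ℤ, ∑' j : ℤ, |(j : ℝ)| ^ r * ‖u j‖ * ‖u (k - j)‖ =
      ∑' j : ℤ, ‖u j‖ * (|((k - j : ℤ) : ℝ)| ^ r * ‖u (k - j)‖) := fun k => by
    rw [← (Equiv.subLeft k).tsum_eq]
    refine tsum_congr fun j => ?_
    simp only [Equiv.subLeft_apply, sub_sub_cancel]
    ring
  have hk : ∀ k : ℤ, |(k : ℝ)| ^ r * ‖conv u u k‖ ≤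
      2 ^ (r - 1) * 2 * ∑' j : ℤ, ‖u j‖ * (|((k - j : ℤ) : ℝ)| ^ r * ‖u (k - j)‖) := fun k => by
    have hn := summable_norm_mul_shift hu.summable_norm (norm_le_tsum_norm hu.summable_norm) k
    have hpt : ∀ j : ℤ, |(k : ℝ)| ^ r * (‖u j‖ * ‖u (k - j)‖) ≤
        2 ^ (r - 1) * (|(j : ℝ)| ^ r * ‖u j‖ * ‖u (k - j)‖ +
          ‖u j‖ * (|((k - j : ℤ) : ℝ)| ^ r * ‖u (k - j)‖)) := fun j => by
      -- Convexity of the power distributes |k|^r over the frequencies j and k − j with constant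
      -- 2^(r-1). The two resulting sums coincide by the symmetry j ↦ k − j, hence the further
      -- factor 2.
      have h1 : |(k : ℝ)| ^ r ≤ 2 ^ (r - 1) * (|(j : ℝ)| ^ r + |((k - j : ℤ) : ℝ)| ^ r) := by
        refine le_trans (pow_le_pow_left₀ (abs_nonneg _) ?_ r)
          (add_pow_le (abs_nonneg _) (abs_nonneg _) r)
        have := abs_add_le (j : ℝ) ((k - j : ℤ) : ℝ)
        push_cast at this ⊢
        rwa [add_sub_cancel] at this
      have h2 := mul_le_mul_of_nonneg_right h1
        (mul_nonneg (norm_nonneg (u j)) (norm_nonneg (u (k - j))))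
      linarith
    calc |(k : ℝ)| ^ r * ‖conv u u k‖ ≤ |(k : ℝ)| ^ r * ∑' j, ‖u j‖ * ‖u (k - j)‖ := by
          gcongr
          exact norm_conv_le hu.summable_norm (norm_le_tsum_norm hu.summable_norm) k
      _ = ∑' j, |(k : ℝ)| ^ r * (‖u j‖ * ‖u (k - j)‖) := tsum_mul_left.symm
      _ ≤ ∑' j : ℤ, 2 ^ (r - 1) * (|(j : ℝ)| ^ r * ‖u j‖ * ‖u (k - j)‖ +
          ‖u j‖ * (|((k - j : ℤ) : ℝ)| ^ r * ‖u (k - j)‖)) :=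
        (hn.mul_left _).tsum_le_tsum hpt (((hs2 k).add (hs k)).mul_left _)
      _ = 2 ^ (r - 1) * 2 * ∑' j : ℤ, ‖u j‖ * (|((k - j : ℤ) : ℝ)| ^ r * ‖u (k - j)‖) := by
        rw [tsum_mul_left, (hs2 k).tsum_add (hs k), heq]; ring
  calc ∑ k ∈ S, (|(k : ℝ)| ^ r * ‖conv u u k‖) ^ 2
      ≤ ∑ k ∈ S, (2 ^ (r - 1) * 2 *
          ∑' j : ℤ, ‖u j‖ * (|((k - j : ℤ) : ℝ)| ^ r * ‖u (k - j)‖)) ^ 2 := by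
        exact Finset.sum_le_sum fun k _ => pow_le_pow_left₀ (by positivity) (hk k) 2
    _ = (2 ^ (r - 1) * 2) ^ 2 * ∑ k ∈ S,
        (∑' j : ℤ, ‖u j‖ * (|((k - j : ℤ) : ℝ)| ^ r * ‖u (k - j)‖)) ^ 2 := by
        rw [Finset.mul_sum]; simp_rw [mul_pow]
    _ ≤ (2 ^ (r - 1) * 2) ^ 2 * (A * M) ^ 2 := by
        gcongr
        exact sum_sq_tsum_mul_shift_le hu.summable_norm (fun _ => norm_nonneg _)
          (y := fun k : ℤ => |(k : ℝ)| ^ r * ‖u k‖) (fun k => by positivity)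
          hu.summable_pow_sq hu.tsum_norm_le hu.tsum_pow_sq_le S
    _ = _ := by ring

theorem SobolevBound.summable_conv_sq {r : ℕ} {A M : ℝ} {u : ℤ → ℂ} (hu : SobolevBound r A M u) :
    Summable fun k : ℤ => (|(k : ℝ)| ^ r * ‖conv u u k‖) ^ 2 :=
  summable_of_sum_le (fun _ => sq_nonneg _) hu.sum_conv_sq_le

theorem SobolevBound.tsum_conv_sq_le {r : ℕ} {A M : ℝ} {u : ℤ → ℂ} (hu : SobolevBound r A M u) :
    ∑' k : ℤ, (|(k : ℝ)| ^ r * ‖conv u u k‖) ^ 2 ≤ (2 ^ (r - 1) * 2 * (A * M)) ^ 2 :=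
  hu.summable_conv_sq.tsum_le_of_sum_le hu.sum_conv_sq_le

/-- The `ℓ¹` norm of the tail gains one power of `N`. -/
theorem SobolevBound.tsum_tail_le {r : ℕ} {A M : ℝ} {u : ℤ → ℂ} (hu : SobolevBound r A M u)
    {N : ℕ} (hN : 1 ≤ N) :
    (Summable fun k => ‖tail N u k‖) ∧ ∑' k, ‖tail N u k‖ ≤ A * (N : ℝ)⁻¹ := by
  have hN0 : (0 : ℝ) < N := by positivity
  have hle : ∀ k : ℤ, ‖tail N u k‖ ≤ (1 + |(k : ℝ)|) * ‖u k‖ * (N : ℝ)⁻¹ := by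
    intro k
    unfold tail
    split_ifs with h
    · rw [← div_eq_mul_inv, le_div_iff₀ hN0, mul_comm]
      gcongr
      linarith [cast_le_abs_cast h]
    · rw [norm_zero]; positivity
  have hs := hu.summable_one.mul_right (N : ℝ)⁻¹
  have hs' := Summable.of_nonneg_of_le (fun _ => norm_nonneg _) hle hs
  refine ⟨hs', (hs'.tsum_le_tsum hle hs).trans ?_⟩
  rw [tsum_mul_right]
  gcongr
  exact hu.one_le

theorem conv_add_self {a b : ℤ → ℂ} (ha : Summable fun k => ‖a k‖)
    (hb : Summable fun k => ‖b k‖) (k : ℤ) :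
    conv (fun j => a j + b j) (fun j => a j + b j) k =
      conv a a k + 2 * conv a b k + conv b b k := by
  have hab : ∀ k, ‖a k + b k‖ ≤ ∑' j, ‖a j‖ + ∑' j, ‖b j‖ := fun k =>
    (norm_add_le _ _).trans (add_le_add (norm_le_tsum_norm ha k) (norm_le_tsum_norm hb k))
  rw [conv_add_left ha hb hab, conv_comm a, conv_comm b,
    conv_add_left ha hb (norm_le_tsum_norm ha), conv_add_left ha hb (norm_le_tsum_norm hb),
    conv_comm b a]
  ring

theorem conv_sub_self {a b : ℤ → ℂ} (ha : Summable fun k => ‖a k‖)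
    (hb : Summable fun k => ‖b k‖) (k : ℤ) :
    conv (fun j => a j - b j) (fun j => a j - b j) k =
      conv a a k - 2 * conv a b k + conv b b k := by
  have hab : ∀ k, ‖a k - b k‖ ≤ ∑' j, ‖a j‖ + ∑' j, ‖b j‖ := fun k =>
    (norm_sub_le _ _).trans (add_le_add (norm_le_tsum_norm ha k) (norm_le_tsum_norm hb k))
  rw [conv_sub_left ha hb hab, conv_comm a, conv_comm b,
    conv_sub_left ha hb (norm_le_tsum_norm ha), conv_sub_left ha hb (norm_le_tsum_norm hb),
    conv_comm b a]
  ring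

/-- The factorization a² − b² = (a+b)(a−b), which puts the small difference in ℓ² and the sum in ℓ¹.
-/
theorem conv_self_sub_conv_self {a b : ℤ → ℂ} (ha : Summable fun k => ‖a k‖)
    (hb : Summable fun k => ‖b k‖) (k : ℤ) :
    conv a a k - conv b b k = conv (fun j => a j + b j) (fun j => a j - b j) k := by
  have hab : ∀ k, ‖a k - b k‖ ≤ ∑' j, ‖a j‖ + ∑' j, ‖b j‖ := fun k =>
    (norm_sub_le _ _).trans (add_le_add (norm_le_tsum_norm ha k) (norm_le_tsum_norm hb k))
  rw [conv_add_left ha hb hab, conv_comm a fun j => a j - b j,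
    conv_comm b fun j => a j - b j,
    conv_sub_left ha hb (norm_le_tsum_norm ha), conv_sub_left ha hb (norm_le_tsum_norm hb),
    conv_comm b a]
  ring

/-! ### The energy, its normal form correction and their rates -/

/-- The squared `ℓ²` distance at frequencies up to `N`. -/
def errorEnergy (N : ℕ) (u v : ℤ → ℂ) : ℝ :=
  ∑ k ∈ Finset.Icc (-(N : ℤ)) N, ‖u k - v k‖ ^ 2

/-- The time derivative of `errorEnergy` along solutions. -/
def errorEnergyRate (N : ℕ) (u v : ℤ → ℂ) : ℝ :=
  ∑ k ∈ Finset.Icc (-(N : ℤ)) N,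
    2 * (conj (u k - v k) * (kawaharaRhs u k - kawaharaRhs v k)).re

/-- The normal form correction of `errorEnergy`. -/
def normalForm (N : ℕ) (u v : ℤ → ℂ) : ℝ :=
  ∑ k ∈ Finset.Icc (-(N : ℤ)) N, ∑ a ∈ Finset.Icc (-(N : ℤ)) N,
    nfCoef a (k - a) * (u a * tail N u (k - a) * conj (u k - v k)).re

/-- The time derivative of `normalForm` along solutions. -/
def normalFormRate (N : ℕ) (u v : ℤ → ℂ) : ℝ :=
  ∑ k ∈ Finset.Icc (-(N : ℤ)) N, ∑ a ∈ Finset.Icc (-(N : ℤ)) N,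
    nfCoef a (k - a) * ((kawaharaRhs u a * tail N u (k - a) +
      u a * tail N (kawaharaRhs u) (k - a)) * conj (u k - v k) +
      u a * tail N u (k - a) * conj (kawaharaRhs u k - kawaharaRhs v k)).re

/-- The dispersive part contributes iω(k)|u_k − v_k|², which is purely imaginary, so only the
nonlinearity survives. -/
theorem errorEnergyRate_eq (N : ℕ) (u v : ℤ → ℂ) :
    errorEnergyRate N u v = (∑ k ∈ Finset.Icc (-(N : ℤ)) N,
      -(Complex.I * k) * (conv u u k - conv v v k) * conj (u k - v k)).re := by
  unfold errorEnergyRate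
  rw [Complex.re_sum]
  refine Finset.sum_congr rfl fun k _ => ?_
  have h : conj (u k - v k) * (kawaharaRhs u k - kawaharaRhs v k) =
      ((omega k * ‖u k - v k‖ ^ 2 : ℝ) : ℂ) * Complex.I +
        (1 / 2 : ℝ) * (-(Complex.I * k) * (conv u u k - conv v v k) * conj (u k - v k)) := by
    have h1 : conj (u k - v k) * (u k - v k) = ((‖u k - v k‖ ^ 2 : ℝ) : ℂ) := by
      rw [mul_comm, Complex.mul_conj, Complex.normSq_eq_norm_sq]
    unfold kawaharaRhs
    rw [Complex.ofReal_mul, ← h1]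
    push_cast
    ring
  rw [h, Complex.add_re, Complex.re_ofReal_mul, Complex.re_ofReal_mul, Complex.I_re]
  ring

/-- The linear parts of the three time derivatives add up to the phase times i; multiplied by the
coefficient this is the term −2ik that the correction must reproduce. The other three terms come
from the nonlinearity acting on each factor in turn. -/
theorem nfCoef_mul_rate_eq {N : ℕ} (u v : ℤ → ℂ) {k : ℤ} (hk : k ∈ Finset.Icc (-(N : ℤ)) N)
    (a : ℤ) :
    nfCoef a (k - a) * ((kawaharaRhs u a * tail N u (k - a) +
      u a * tail N (kawaharaRhs u) (k - a)) * conj (u k - v k) +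
      u a * tail N u (k - a) * conj (kawaharaRhs u k - kawaharaRhs v k)).re =
    (-(Complex.I * k) * (2 * (u a * tail N u (k - a))) * conj (u k - v k)).re +
    (nfCoef a (k - a) *
      (-(Complex.I * a / 2) * conv u u a * tail N u (k - a) * conj (u k - v k)).re +
    nfCoef a (k - a) * (-(Complex.I * (k - a) / 2) * u a * tail N (conv u u) (k - a) *
      conj (u k - v k)).re +
    nfCoef a (k - a) * (Complex.I * k / 2 * u a * tail N u (k - a) *
      conj (conv u u k - conv v v k)).re) := by
  by_cases h : (N : ℤ) < |k - a|
  · simp only [tail, if_pos h]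
    -- If a were zero, the frequency k − a in the tail would be k itself, which is at most N in
    -- size.
    have ha : a ≠ 0 := by
      rintro rfl
      rw [sub_zero] at h
      exact not_mem_Icc_iff.mpr h hk
    have hph := nfCoef_mul_phase ha (ne_zero_of_lt_abs h)
    rw [add_sub_cancel] at hph
    set c := nfCoef a (k - a)
    have hph' : (c : ℂ) * (omega a + omega (k - a) - omega k) = -2 * k := by
      have := congrArg (fun x : ℝ => (x : ℂ)) hph
      push_cast at this
      rw [this]; ring
    simp only [← Complex.re_ofReal_mul, ← Complex.add_re]
    congr 1
    unfold kawaharaRhs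
    simp only [map_sub, map_mul, map_div₀, Complex.conj_I, Complex.conj_ofReal, map_intCast,
      map_ofNat]
    push_cast
    linear_combination Complex.I * u a * u (k - a) * (conj (u k) - conj (v k)) * hph'
  · simp [tail, if_neg h]

theorem conv_head_tail {N : ℕ} (u : ℤ → ℂ) (k : ℤ) :
    conv (head N u) (tail N u) k =
      ∑ a ∈ Finset.Icc (-(N : ℤ)) N, u a * tail N u (k - a) := by
  unfold conv
  rw [tsum_eq_sum (s := Finset.Icc (-(N : ℤ)) N) fun a ha => by
    rw [head, if_pos (not_mem_Icc_iff.mp ha), zero_mul]]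
  exact Finset.sum_congr rfl fun a ha => by rw [head_of_mem u ha]

theorem normalFormRate_eq (N : ℕ) (u v : ℤ → ℂ) :
    normalFormRate N u v = (∑ k ∈ Finset.Icc (-(N : ℤ)) N,
      -(Complex.I * k) * (2 * conv (head N u) (tail N u) k) * conj (u k - v k)).re +
    (∑ k ∈ Finset.Icc (-(N : ℤ)) N, ∑ a ∈ Finset.Icc (-(N : ℤ)) N, nfCoef a (k - a) *
      (-(Complex.I * a / 2) * conv u u a * tail N u (k - a) * conj (u k - v k)).re +
    ∑ k ∈ Finset.Icc (-(N : ℤ)) N, ∑ a ∈ Finset.Icc (-(N : ℤ)) N, nfCoef a (k - a) *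
      (-(Complex.I * (k - a) / 2) * u a * tail N (conv u u) (k - a) * conj (u k - v k)).re +
    ∑ k ∈ Finset.Icc (-(N : ℤ)) N, ∑ a ∈ Finset.Icc (-(N : ℤ)) N, nfCoef a (k - a) *
      (Complex.I * k / 2 * u a * tail N u (k - a) * conj (conv u u k - conv v v k)).re) := by
  have h : (∑ k ∈ Finset.Icc (-(N : ℤ)) N,
      -(Complex.I * k) * (2 * conv (head N u) (tail N u) k) * conj (u k - v k)).re =
      ∑ k ∈ Finset.Icc (-(N : ℤ)) N, ∑ a ∈ Finset.Icc (-(N : ℤ)) N,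
        (-(Complex.I * k) * (2 * (u a * tail N u (k - a))) * conj (u k - v k)).re := by
    rw [Complex.re_sum]
    refine Finset.sum_congr rfl fun k _ => ?_
    rw [conv_head_tail, ← Complex.re_sum, Finset.mul_sum, Finset.mul_sum, Finset.sum_mul]
  rw [h]
  simp only [← Finset.sum_add_distrib]
  unfold normalFormRate
  exact Finset.sum_congr rfl fun k hk => Finset.sum_congr rfl fun a _ =>
    nfCoef_mul_rate_eq u v hk a

theorem TrigBound.summable_norm {N : ℕ} {M : ℝ} {v : ℤ → ℂ} (hv : TrigBound N M v) :
    Summable fun k => ‖v k‖ := (hasSum_of_support hv.support (f := norm) norm_zero).summable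

/-- Cauchy–Schwarz over 2N+1 frequencies. The bound √(2N+1) ≤ 3N is wasteful, but the cubic decay of
the multiplier can afford it. -/
theorem TrigBound.tsum_norm_le {N : ℕ} (hN : 1 ≤ N) {M : ℝ} (hM : 0 ≤ M) {v : ℤ → ℂ}
    (hv : TrigBound N M v) : ∑' k, ‖v k‖ ≤ 3 * N * M := by
  rw [(hasSum_of_support hv.support (f := norm) norm_zero).tsum_eq]
  have h := Real.sum_mul_le_sqrt_mul_sqrt (Finset.Icc (-(N : ℤ)) N) (fun _ => 1) (fun k => ‖v k‖)
  have hN' : (1 : ℝ) ≤ N := by exact_mod_cast hN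
  have h1 : √(∑ k ∈ Finset.Icc (-(N : ℤ)) N, (1 : ℝ) ^ 2) ≤ 3 * N := by
    rw [Real.sqrt_le_iff]
    refine ⟨by positivity, ?_⟩
    have hc : (Finset.Icc (-(N : ℤ)) N).card = 2 * N + 1 := by
      rw [Int.card_Icc]; omega
    simp only [one_pow, Finset.sum_const, hc, nsmul_eq_mul, mul_one]
    push_cast
    nlinarith
  have h2 : √(∑ k ∈ Finset.Icc (-(N : ℤ)) N, ‖v k‖ ^ 2) ≤ M := Real.sqrt_le_iff.mpr ⟨hM, hv.sq_le⟩
  simp only [one_mul] at h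
  exact h.trans (by gcongr)

/-! ### Bounds for the modified energy and its rate -/

section EnergyEstimate

variable {r N : ℕ} {A M : ℝ} {u v : ℤ → ℂ}

theorem errorEnergy_nonneg (N : ℕ) (u v : ℤ → ℂ) : 0 ≤ errorEnergy N u v :=
  Finset.sum_nonneg fun _ _ => sq_nonneg _

theorem SobolevBound.nonneg_left (hu : SobolevBound r A M u) : 0 ≤ A :=
  (tsum_nonneg fun _ => by positivity).trans hu.one_le

theorem SobolevBound.tail_sq (hu : SobolevBound r A M u) (hN : 1 ≤ N) :
    (Summable fun k => ‖tail N u k‖ ^ 2) ∧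
      ∑' k, ‖tail N u k‖ ^ 2 ≤ (M * ((N : ℝ) ^ r)⁻¹) ^ 2 :=
  tail_sq_le hN hu.summable_pow_sq hu.tsum_pow_sq_le

/-- Pythagoras: v has no frequencies above N, so the low-frequency error and the tail of u are
orthogonal. -/
theorem hasSum_sq_sub (hv : TrigBound N M v) (ht : Summable fun k => ‖tail N u k‖ ^ 2) :
    HasSum (fun k => ‖u k - v k‖ ^ 2) (errorEnergy N u v + ∑' k, ‖tail N u k‖ ^ 2) := by
  have h1 : HasSum (fun k => ‖head N u k - v k‖ ^ 2) (errorEnergy N u v) := by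
    have := hasSum_of_support (θ := fun k => head N u k - v k) (N := N)
      (fun k hk => by simp [head, if_pos hk, hv.support k hk]) (f := fun z => ‖z‖ ^ 2) (by simp)
    convert this using 1
    exact Finset.sum_congr rfl fun k hk => by rw [head_of_mem u hk]
  refine (h1.add ht.hasSum).congr_fun fun k => ?_
  by_cases h : (N : ℤ) < |k|
  · simp [head, tail, if_pos h, hv.support k h]
  · simp [head, tail, if_neg h]

theorem sum_sq_conv_sub_conv_le (hN : 1 ≤ N) (hM : 0 ≤ M) (hu : SobolevBound r A M u)
    (hv : TrigBound N M v) (S : Finset ℤ) :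
    ∑ k ∈ S, ‖conv u u k - conv v v k‖ ^ 2 ≤
      ((A + 3 * N * M) * (√(errorEnergy N u v) + M * ((N : ℝ) ^ r)⁻¹)) ^ 2 := by
  have hsum := hasSum_sq_sub hv (hu.tail_sq hN).1
  have hadd : ∀ k, ‖u k + v k‖ ≤ ‖u k‖ + ‖v k‖ := fun k => norm_add_le _ _
  have hs := hu.summable_norm.add hv.summable_norm
  have hs' : Summable fun k => ‖u k + v k‖ :=
    Summable.of_nonneg_of_le (fun _ => norm_nonneg _) hadd hs
  simp only [conv_self_sub_conv_self hu.summable_norm hv.summable_norm]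
  refine sum_sq_norm_conv_le hs' hsum.summable ?_ ?_ S
  · refine (hs'.tsum_le_tsum hadd hs).trans ?_
    rw [hu.summable_norm.tsum_add hv.summable_norm]
    exact add_le_add hu.tsum_norm_le (hv.tsum_norm_le hN hM)
  · rw [hsum.tsum_eq]
    have h1 := Real.sq_sqrt (errorEnergy_nonneg N u v)
    have h2 := (hu.tail_sq hN).2
    have h3 : 0 ≤ √(errorEnergy N u v) * (M * ((N : ℝ) ^ r)⁻¹) := by positivity
    nlinarith

theorem sum_sq_sqrt (N : ℕ) (u v : ℤ → ℂ) :
    ∑ k ∈ Finset.Icc (-(N : ℤ)) N, ‖conj (u k - v k)‖ ^ 2 ≤ √(errorEnergy N u v) ^ 2 := by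
  rw [Real.sq_sqrt (errorEnergy_nonneg N u v)]
  simp only [Complex.norm_conj]
  rfl

theorem abs_normalForm_le (hN : 1 ≤ N) (hM : 0 ≤ M) (hu : SobolevBound r A M u) (v : ℤ → ℂ) :
    |normalForm N u v| ≤ A * (M * ((N : ℝ) ^ r)⁻¹) * √(errorEnergy N u v) := by
  refine abs_sum_trilinear_le (x := u) (y := tail N u) (z := fun k => conj (u k - v k))
    (by positivity) (Real.sqrt_nonneg _) (fun k _ a _ => ?_)
    ((hu.summable_norm.sum_le_tsum _ fun _ _ => norm_nonneg _).trans hu.tsum_norm_le)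
    (hu.tail_sq hN).1 (hu.tail_sq hN).2 (sum_sq_sqrt N u v)
  by_cases h : (N : ℤ) < |k - a|
  · rw [norm_mul, norm_mul]
    exact mul_le_of_le_one_right (by positivity) (abs_nfCoef_le_one _ (ne_zero_of_lt_abs h))
  · simp [tail, if_neg h]

/-- With θ = head − v, expand u = head + tail and v = head − θ. The squares of the head cancel and
the θ² term drops out as a total derivative, leaving head–tail, tail–tail and transport terms. The
first is the one the normal form reproduces. -/
theorem errorEnergyRate_sub_eq (hu : SobolevBound r A M u) (hN : 1 ≤ N) (hv : TrigBound N M v) :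
    errorEnergyRate N u v = (∑ k ∈ Finset.Icc (-(N : ℤ)) N,
      -(Complex.I * k) * (2 * conv (head N u) (tail N u) k) * conj (u k - v k)).re +
    (∑ k ∈ Finset.Icc (-(N : ℤ)) N,
      -(Complex.I * k) * conv (tail N u) (tail N u) k * conj (u k - v k)).re +
    2 * (∑ k ∈ Finset.Icc (-(N : ℤ)) N, -(Complex.I * k) *
      conv (head N u) (fun k => head N u k - v k) k * conj (head N u k - v k)).re := by
  have hh : Summable fun k => ‖head N u k‖ :=
    Summable.of_nonneg_of_le (fun _ => norm_nonneg _) (norm_head_le N u) hu.summable_norm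
  have ht := (hu.tsum_tail_le hN).1
  set θ : ℤ → ℂ := fun k => head N u k - v k with hθ
  have hsupp : ∀ k : ℤ, (N : ℤ) < |k| → θ k = 0 := fun k hk => by
    simp [hθ, head, if_pos hk, hv.support k hk]
  have hconj : ∀ k, θ (-k) = conj (θ k) := fun k => by
    simp only [hθ, head, abs_neg, hu.conj_symm, hv.conj_symm, map_sub]
    split_ifs <;> simp
  have hθs : Summable fun k => ‖θ k‖ := (hasSum_of_support hsupp (f := norm) norm_zero).summable
  have hu' : u = fun k => head N u k + tail N u k := by
    funext k; exact (head_add_tail N u k).symm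
  have hv' : v = fun k => head N u k - θ k := by funext k; simp [hθ]
  have hcu : ∀ k, conv u u k = conv (head N u) (head N u) k +
      2 * conv (head N u) (tail N u) k + conv (tail N u) (tail N u) k := fun k => by
    rw [← conv_add_self hh ht]; rw [← hu']
  have hcv : ∀ k, conv v v k = conv (head N u) (head N u) k -
      2 * conv (head N u) θ k + conv θ θ k := fun k => by
    rw [← conv_sub_self hh hθs]; rw [← hv']
  have key : ∑ k ∈ Finset.Icc (-(N : ℤ)) N,
      -(Complex.I * k) * (conv u u k - conv v v k) * conj (u k - v k) =
      ∑ k ∈ Finset.Icc (-(N : ℤ)) N,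
        -(Complex.I * k) * (2 * conv (head N u) (tail N u) k) * conj (u k - v k) +
      ∑ k ∈ Finset.Icc (-(N : ℤ)) N,
        -(Complex.I * k) * conv (tail N u) (tail N u) k * conj (u k - v k) +
      (2 : ℝ) * ∑ k ∈ Finset.Icc (-(N : ℤ)) N,
        -(Complex.I * k) * conv (head N u) θ k * conj (θ k) -
      ∑ k ∈ Finset.Icc (-(N : ℤ)) N, -(Complex.I * k) * conv θ θ k * conj (θ k) := by
    rw [Finset.mul_sum, ← Finset.sum_add_distrib, ← Finset.sum_add_distrib,
      ← Finset.sum_sub_distrib]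
    refine Finset.sum_congr rfl fun k hk => ?_
    rw [hcu, hcv, show θ k = u k - v k by simp only [hθ, head_of_mem u hk]]
    push_cast
    ring
  rw [errorEnergyRate_eq, key, sum_conv_self_eq_zero hsupp hconj, sub_zero, Complex.add_re,
    Complex.add_re, Complex.re_ofReal_mul]

theorem norm_I_mul_int_div_two (a : ℤ) : ‖Complex.I * a / 2‖ = |(a : ℝ)| / 2 := by
  rw [norm_div, norm_mul, Complex.norm_I, Complex.norm_intCast, Complex.norm_ofNat, one_mul]

theorem abs_remainder_left_le (hN : 1 ≤ N) (hM : 0 ≤ M) (hu : SobolevBound r A M u) (v : ℤ → ℂ) :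
    |∑ k ∈ Finset.Icc (-(N : ℤ)) N, ∑ a ∈ Finset.Icc (-(N : ℤ)) N, nfCoef a (k - a) *
      (-(Complex.I * a / 2) * conv u u a * tail N u (k - a) * conj (u k - v k)).re| ≤
    A * A * (M * ((N : ℝ) ^ r)⁻¹) * √(errorEnergy N u v) := by
  refine abs_sum_trilinear_le (x := conv u u) (y := tail N u) (z := fun k => conj (u k - v k))
    (by positivity) (Real.sqrt_nonneg _) (fun k _ a _ => ?_)
    (sum_norm_conv_le hu.summable_norm hu.summable_norm hu.tsum_norm_le hu.tsum_norm_le _)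
    (hu.tail_sq hN).1 (hu.tail_sq hN).2 (sum_sq_sqrt N u v)
  by_cases h : (N : ℤ) < |k - a|
  · rw [norm_mul, norm_mul, norm_mul, norm_neg, norm_I_mul_int_div_two]
    have h1 := abs_nfCoef_mul_abs_left_le a (ne_zero_of_lt_abs h)
    calc _ = (‖conv u u a‖ * ‖tail N u (k - a)‖ * ‖conj (u k - v k)‖) *
          (|nfCoef a (k - a)| * |(a : ℝ)| / 2) := by ring
      _ ≤ _ := mul_le_of_le_one_right (by positivity) (by linarith)
  · simp [tail, if_neg h]

theorem abs_remainder_middle_le (hN : 1 ≤ N) (hM : 0 ≤ M) (hu : SobolevBound r A M u)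
    (v : ℤ → ℂ) :
    |∑ k ∈ Finset.Icc (-(N : ℤ)) N, ∑ a ∈ Finset.Icc (-(N : ℤ)) N, nfCoef a (k - a) *
      (-(Complex.I * (k - a) / 2) * u a * tail N (conv u u) (k - a) * conj (u k - v k)).re| ≤
    A * (2 ^ (r - 1) * 2 * (A * M) * ((N : ℝ) ^ r)⁻¹) * √(errorEnergy N u v) := by
  have hA := hu.nonneg_left
  have ht := tail_sq_le hN hu.summable_conv_sq hu.tsum_conv_sq_le
  refine abs_sum_trilinear_le (x := u) (y := tail N (conv u u)) (z := fun k => conj (u k - v k))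
    (by positivity) (Real.sqrt_nonneg _) (fun k _ a _ => ?_)
    ((hu.summable_norm.sum_le_tsum _ fun _ _ => norm_nonneg _).trans hu.tsum_norm_le)
    ht.1 ht.2 (sum_sq_sqrt N u v)
  by_cases h : (N : ℤ) < |k - a|
  · rw [norm_mul, norm_mul, norm_mul, norm_neg, ← Int.cast_sub, norm_I_mul_int_div_two]
    have h1 := abs_nfCoef_mul_abs_right_le a (ne_zero_of_lt_abs h)
    calc _ = (‖u a‖ * ‖tail N (conv u u) (k - a)‖ * ‖conj (u k - v k)‖) *
          (|nfCoef a (k - a)| * |((k - a : ℤ) : ℝ)| / 2) := by ring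
      _ ≤ _ := mul_le_of_le_one_right (by positivity) (by linarith)
  · simp [tail, if_neg h]

theorem abs_remainder_right_le (hN : 1 ≤ N) (hM : 0 ≤ M) (hu : SobolevBound r A M u)
    (hv : TrigBound N M v) :
    |∑ k ∈ Finset.Icc (-(N : ℤ)) N, ∑ a ∈ Finset.Icc (-(N : ℤ)) N, nfCoef a (k - a) *
      (Complex.I * k / 2 * u a * tail N u (k - a) * conj (conv u u k - conv v v k)).re| ≤
    A * (M * ((N : ℝ) ^ r)⁻¹) *
      ((A + 3 * M) * (√(errorEnergy N u v) + M * ((N : ℝ) ^ r)⁻¹)) := by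
  have hA := hu.nonneg_left
  have hN' : (1 : ℝ) ≤ N := by exact_mod_cast hN
  have hNp : (0 : ℝ) < N := by linarith
  -- The factor N⁻¹ attached to the third sequence is supplied by the multiplier. It offsets the
  -- growth 3NM of the ℓ¹ bound for v.
  refine abs_sum_trilinear_le (x := u) (y := tail N u)
    (z := fun k => ((N : ℝ)⁻¹ : ℂ) * (conv u u k - conv v v k))
    (by positivity) (by positivity) (fun k hk a _ => ?_)
    ((hu.summable_norm.sum_le_tsum _ fun _ _ => norm_nonneg _).trans hu.tsum_norm_le)
    (hu.tail_sq hN).1 (hu.tail_sq hN).2 ?_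
  · by_cases h : (N : ℤ) < |k - a|
    · rw [norm_mul, norm_mul, norm_mul, norm_I_mul_int_div_two, norm_mul, Complex.norm_conj,
        norm_inv, Complex.norm_real, Real.norm_natCast]
      have h1 := abs_nfCoef_mul_cube_le a (k - a)
      have h2 := cast_le_abs_cast h
      have hk' : |(k : ℝ)| ≤ N := by
        have := abs_le.mpr (Finset.mem_Icc.mp hk)
        exact_mod_cast this
      -- Of the decay N⁻³ of the multiplier, one power pays for |k| ≤ N and one for the required
      -- N⁻¹; the third is not needed.
      have h3 : |nfCoef a (k - a)| * |(k : ℝ)| / 2 ≤ (N : ℝ)⁻¹ := by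
        have h4 : |nfCoef a (k - a)| * (N : ℝ) ^ 3 ≤ 1 := le_trans (by gcongr) h1
        rw [← one_div, le_div_iff₀ hNp]
        have h5 : |nfCoef a (k - a)| * (|(k : ℝ)| * N) ≤ |nfCoef a (k - a)| * (N : ℝ) ^ 3 := by
          gcongr
          calc |(k : ℝ)| * N ≤ N * N := by gcongr
            _ ≤ (N : ℝ) ^ 3 := by nlinarith [mul_pos hNp hNp]
        have := mul_nonneg (abs_nonneg (nfCoef a (k - a)))
          (mul_nonneg (abs_nonneg (k : ℝ)) hNp.le)
        linarith
      calc _ = (‖u a‖ * ‖tail N u (k - a)‖ * ‖conv u u k - conv v v k‖) *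
            (|nfCoef a (k - a)| * |(k : ℝ)| / 2) := by ring
        _ ≤ (‖u a‖ * ‖tail N u (k - a)‖ * ‖conv u u k - conv v v k‖) * (N : ℝ)⁻¹ := by gcongr
        _ = _ := by ring
    · simp [tail, if_neg h]
  · simp only [norm_mul, norm_inv, Complex.norm_real, Real.norm_natCast, mul_pow]
    rw [← Finset.mul_sum]
    calc _ ≤ ((N : ℝ)⁻¹) ^ 2 *
          ((A + 3 * N * M) * (√(errorEnergy N u v) + M * ((N : ℝ) ^ r)⁻¹)) ^ 2 := by
          gcongr
          exact sum_sq_conv_sub_conv_le hN hM hu hv _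
      _ = (((N : ℝ)⁻¹ * (A + 3 * N * M)) *
          (√(errorEnergy N u v) + M * ((N : ℝ) ^ r)⁻¹)) ^ 2 := by ring
      _ ≤ ((A + 3 * M) * (√(errorEnergy N u v) + M * ((N : ℝ) ^ r)⁻¹)) ^ 2 := by
          gcongr
          rw [inv_mul_le_iff₀ hNp]
          nlinarith
      _ = _ := by rw [mul_pow]

theorem abs_tail_tail_le (hN : 1 ≤ N) (hM : 0 ≤ M) (hu : SobolevBound r A M u) (v : ℤ → ℂ) :
    |(∑ k ∈ Finset.Icc (-(N : ℤ)) N,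
      -(Complex.I * k) * conv (tail N u) (tail N u) k * conj (u k - v k)).re| ≤
    A * (M * ((N : ℝ) ^ r)⁻¹) * √(errorEnergy N u v) := by
  have hA := hu.nonneg_left
  have hNp : (0 : ℝ) < N := by positivity
  have hNc : (N : ℂ) ≠ 0 := by exact_mod_cast hNp.ne'
  -- Writing k = (k/N)·N leaves a coefficient of size at most 1; the N is absorbed by the N⁻¹ gained
  -- by the ℓ¹ norm of the tail.
  have h := abs_re_sum_mul_le (S := Finset.Icc (-(N : ℤ)) N)
    (c := fun k => -(Complex.I * k) / N) (g := fun k => N * conv (tail N u) (tail N u) k)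
    (z := fun k => conj (u k - v k)) (G := A * (M * ((N : ℝ) ^ r)⁻¹))
    (Z := √(errorEnergy N u v)) (by positivity) (Real.sqrt_nonneg _) ?_ ?_ (sum_sq_sqrt N u v)
  · convert h using 3
    refine Finset.sum_congr rfl fun k _ => ?_
    field_simp
  · intro k hk
    have hk' : |(k : ℝ)| ≤ N := by
      have := abs_le.mpr (Finset.mem_Icc.mp hk)
      exact_mod_cast this
    rw [norm_div, norm_neg, norm_mul, Complex.norm_I, Complex.norm_intCast, Complex.norm_natCast,
      one_mul]
    exact (div_le_one hNp).mpr hk'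
  · simp only [norm_mul, Complex.norm_natCast, mul_pow]
    rw [← Finset.mul_sum]
    have ht := hu.tsum_tail_le hN
    calc _ ≤ (N : ℝ) ^ 2 * (A * (N : ℝ)⁻¹ * (M * ((N : ℝ) ^ r)⁻¹)) ^ 2 := by
          gcongr
          exact sum_sq_norm_conv_le ht.1 (hu.tail_sq hN).1 ht.2 (hu.tail_sq hN).2 _
      _ = _ := by field_simp

/-- The constant in the energy estimate. -/
def energyConst (r : ℕ) (A M : ℝ) : ℝ :=
  A * M + A + A * A * M + A * (2 ^ (r - 1) * 2 * (A * M)) + A * M * (A + 3 * M) * (1 + M)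

/-- The modified energy estimate. -/
theorem errorEnergyRate_sub_normalFormRate_le (hN : 1 ≤ N) (hM : 0 ≤ M)
    (hu : SobolevBound r A M u) (hv : TrigBound N M v) :
    errorEnergyRate N u v - normalFormRate N u v ≤
      energyConst r A M * (errorEnergy N u v + (((N : ℝ) ^ r)⁻¹) ^ 2) := by
  have hA := hu.nonneg_left
  have hE := errorEnergy_nonneg N u v
  have h1 := (abs_le.mp (abs_remainder_left_le hN hM hu v)).1
  have h2 := (abs_le.mp (abs_remainder_middle_le hN hM hu v)).1
  have h3 := (abs_le.mp (abs_remainder_right_le hN hM hu hv)).1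
  have h4 := (abs_le.mp (abs_tail_tail_le hN hM hu v)).2
  have h5 : (∑ k ∈ Finset.Icc (-(N : ℤ)) N, -(Complex.I * k) *
      conv (head N u) (fun k => head N u k - v k) k * conj (head N u k - v k)).re ≤
      A / 2 * errorEnergy N u v := by
    have hle : ∀ k : ℤ, (1 + |(k : ℝ)|) * ‖head N u k‖ ≤ (1 + |(k : ℝ)|) * ‖u k‖ := fun k => by
      gcongr
      exact norm_head_le N u k
    have hs : Summable fun k : ℤ => (1 + |(k : ℝ)|) * ‖head N u k‖ :=
      Summable.of_nonneg_of_le (fun _ => by positivity) hle hu.summable_one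
    refine ((abs_le.mp (abs_re_sum_conv_le (θ := fun k => head N u k - v k) ?_ ?_ hs
      ((hs.tsum_le_tsum hle hu.summable_one).trans hu.one_le))).2).trans_eq ?_
    · intro k hk
      simp [head, if_pos hk, hv.support k hk]
    · intro k
      simp only [head, abs_neg, hu.conj_symm, hv.conj_symm, map_sub]
      split_ifs <;> simp
    · congr 1
      exact Finset.sum_congr rfl fun k hk => by rw [head_of_mem u hk]
  rw [errorEnergyRate_sub_eq hu hN hv, normalFormRate_eq]
  set ε := ((N : ℝ) ^ r)⁻¹
  set Z := √(errorEnergy N u v) with hZ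
  have hε : 0 ≤ ε := by positivity
  have hZ0 : 0 ≤ Z := Real.sqrt_nonneg _
  have hZE : errorEnergy N u v = Z ^ 2 := (Real.sq_sqrt hE).symm
  rw [hZE] at h5 ⊢
  have hεZ : ε * Z ≤ Z ^ 2 + ε ^ 2 := by nlinarith [sq_nonneg (ε - Z)]
  have g1 : A * A * (M * ε) * Z ≤ A * A * M * (Z ^ 2 + ε ^ 2) := by
    have := mul_le_mul_of_nonneg_left hεZ (by positivity : 0 ≤ A * A * M)
    linarith
  have g2 : A * (2 ^ (r - 1) * 2 * (A * M) * ε) * Z ≤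
      A * (2 ^ (r - 1) * 2 * (A * M)) * (Z ^ 2 + ε ^ 2) := by
    have := mul_le_mul_of_nonneg_left hεZ (by positivity : 0 ≤ A * (2 ^ (r - 1) * 2 * (A * M)))
    linarith
  have g3 : A * (M * ε) * ((A + 3 * M) * (Z + M * ε)) ≤
      A * M * (A + 3 * M) * (1 + M) * (Z ^ 2 + ε ^ 2) := by
    have h6 : ε * Z + M * ε ^ 2 ≤ (1 + M) * (Z ^ 2 + ε ^ 2) := by
      nlinarith [mul_nonneg hM (sq_nonneg Z)]
    have := mul_le_mul_of_nonneg_left h6 (by positivity : 0 ≤ A * M * (A + 3 * M))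
    linarith
  have g4 : A * (M * ε) * Z ≤ A * M * (Z ^ 2 + ε ^ 2) := by
    have := mul_le_mul_of_nonneg_left hεZ (by positivity : 0 ≤ A * M)
    linarith
  have g5 : A * Z ^ 2 ≤ A * (Z ^ 2 + ε ^ 2) := by
    gcongr
    nlinarith
  unfold energyConst
  linarith

end EnergyEstimate

/-! ### Differentiation along solutions, Grönwall and conservation -/

theorem hasDerivWithinAt_errorEnergy {N : ℕ} {u v : ℝ → ℤ → ℂ} {s : Set ℝ} {t : ℝ}
    (hu : ∀ k, HasDerivWithinAt (fun τ => u τ k) (kawaharaRhs (u t) k) s t)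
    (hv : ∀ k ∈ Finset.Icc (-(N : ℤ)) N,
      HasDerivWithinAt (fun τ => v τ k) (kawaharaRhs (v t) k) s t) :
    HasDerivWithinAt (fun τ => errorEnergy N (u τ) (v τ)) (errorEnergyRate N (u t) (v t)) s t := by
  unfold errorEnergy errorEnergyRate
  refine HasDerivWithinAt.fun_sum fun k hk => ?_
  have h := ((hu k).sub (hv k hk)).norm_sq
  rw [Complex.inner, mul_comm (_ : ℂ) (conj _)] at h
  exact h

theorem hasDerivWithinAt_normalForm {N : ℕ} {u v : ℝ → ℤ → ℂ} {s : Set ℝ} {t : ℝ}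
    (hu : ∀ k, HasDerivWithinAt (fun τ => u τ k) (kawaharaRhs (u t) k) s t)
    (hv : ∀ k ∈ Finset.Icc (-(N : ℤ)) N,
      HasDerivWithinAt (fun τ => v τ k) (kawaharaRhs (v t) k) s t) :
    HasDerivWithinAt (fun τ => normalForm N (u τ) (v τ)) (normalFormRate N (u t) (v t)) s t := by
  unfold normalForm normalFormRate
  refine HasDerivWithinAt.fun_sum fun k hk => HasDerivWithinAt.fun_sum fun a _ => ?_
  have ht : HasDerivWithinAt (fun τ => tail N (u τ) (k - a))
      (tail N (kawaharaRhs (u t)) (k - a)) s t := by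
    unfold tail
    split_ifs
    · exact hu _
    · exact hasDerivWithinAt_const _ _ _
  have h := (((hu a).mul ht).mul ((hu k).sub (hv k hk)).star)
  exact (Complex.reCLM.hasFDerivAt.comp_hasDerivWithinAt t h).const_mul _

/-- The error bound for the truncated system, by Grönwall's inequality for the modified energy. -/
theorem errorEnergy_le {r N : ℕ} (hN : 1 ≤ N) {A M T : ℝ} (hM : 0 ≤ M) {u v : ℝ → ℤ → ℂ}
    (hu : ∀ t ∈ Set.Icc 0 T, SobolevBound r A M (u t))
    (hv : ∀ t ∈ Set.Icc 0 T, TrigBound N M (v t))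
    (hu' : ∀ t ∈ Set.Icc 0 T, ∀ k,
      HasDerivWithinAt (fun τ => u τ k) (kawaharaRhs (u t) k) (Set.Ici 0) t)
    (hv' : ∀ t ∈ Set.Icc 0 T, ∀ k ∈ Finset.Icc (-(N : ℤ)) N,
      HasDerivWithinAt (fun τ => v τ k) (kawaharaRhs (v t) k) (Set.Ici 0) t)
    (h0 : ∀ k ∈ Finset.Icc (-(N : ℤ)) N, v 0 k = u 0 k) {t : ℝ} (ht : t ∈ Set.Icc 0 T) :
    errorEnergy N (u t) (v t) ≤
      ((A * M) ^ 2 + 1) * Real.exp (2 * energyConst r A M * T) * (((N : ℝ) ^ r)⁻¹) ^ 2 := by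
  set ε := ((N : ℝ) ^ r)⁻¹ with hεd
  have hε : 0 ≤ ε := by positivity
  have hA := (hu t ht).nonneg_left
  set K := energyConst r A M with hK
  have hK0 : 0 ≤ K := by rw [hK]; unfold energyConst; positivity
  -- By Young's inequality the correction is at most E/2 + (AMε)²/2, where E is the error energy.
  -- This c compensates the second part and leaves ε²/2 over, so that 2F ≥ E + ε².
  set c : ℝ := ((A * M) ^ 2 + 1) / 2 with hc
  set F : ℝ → ℝ := fun τ => errorEnergy N (u τ) (v τ) - normalForm N (u τ) (v τ) + c * ε ^ 2
    with hF
  have hFd : ∀ τ ∈ Set.Icc 0 T, HasDerivWithinAt F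
      (errorEnergyRate N (u τ) (v τ) - normalFormRate N (u τ) (v τ)) (Set.Ici 0) τ :=
    fun τ hτ => ((hasDerivWithinAt_errorEnergy (hu' τ hτ) (hv' τ hτ)).sub
      (hasDerivWithinAt_normalForm (hu' τ hτ) (hv' τ hτ))).add_const _
  have hEF : ∀ τ ∈ Set.Icc 0 T, errorEnergy N (u τ) (v τ) + ε ^ 2 ≤ 2 * F τ := fun τ hτ => by
    have h1 := (abs_le.mp (abs_normalForm_le hN hM (hu τ hτ) (v τ))).2
    have h2 := Real.sq_sqrt (errorEnergy_nonneg N (u τ) (v τ))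
    simp only [hF, hc]
    nlinarith [sq_nonneg (A * M * ε - √(errorEnergy N (u τ) (v τ)))]
  -- Since F also dominates ε²/2, the forcing term of size ε² is absorbed into 2K·F and the
  -- inequality is homogeneous. The initial value is cε², because the low-frequency error vanishes
  -- at time 0.
  have hgr := le_gronwallBound_of_liminf_deriv_right_le (f := F)
    (f' := fun τ => errorEnergyRate N (u τ) (v τ) - normalFormRate N (u τ) (v τ))
    (δ := c * ε ^ 2) (K := 2 * K) (ε := 0) (a := 0) (b := T)
    (fun τ hτ => ((hFd τ hτ).continuousWithinAt).mono Set.Icc_subset_Ici_self)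
    (fun τ hτ ρ hρ => ((hFd τ (Set.Ico_subset_Icc_self hτ)).mono
      (Set.Ici_subset_Ici.mpr hτ.1)).liminf_right_slope_le hρ)
    (by
      have he : errorEnergy N (u 0) (v 0) = 0 :=
        Finset.sum_eq_zero fun k hk => by simp [h0 k hk]
      have hb : normalForm N (u 0) (v 0) = 0 :=
        Finset.sum_eq_zero fun k hk => Finset.sum_eq_zero fun a _ => by simp [h0 k hk]
      simp [hF, he, hb])
    (fun τ hτ => by
      have hτ' := Set.Ico_subset_Icc_self hτ
      have h1 := errorEnergyRate_sub_normalFormRate_le hN hM (hu τ hτ') (hv τ hτ')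
      have h2 := mul_le_mul_of_nonneg_left (hEF τ hτ') hK0
      simp only [add_zero]
      linarith) t ht
  rw [gronwallBound_ε0, sub_zero] at hgr
  have h3 : Real.exp (2 * K * t) ≤ Real.exp (2 * K * T) := by
    gcongr
    exact ht.2
  have h4 := hEF t ht
  have h5 : c * ε ^ 2 * Real.exp (2 * K * t) ≤ c * ε ^ 2 * Real.exp (2 * K * T) := by gcongr
  have h6 := sq_nonneg ε
  calc errorEnergy N (u t) (v t) ≤ 2 * (c * ε ^ 2 * Real.exp (2 * K * T)) := by linarith
    _ = _ := by rw [hc]; ring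

theorem eq_of_hasDerivWithinAt_zero {E : Type*} [NormedAddCommGroup E] [NormedSpace ℝ E]
    {g : ℝ → E} (hg : ∀ t, 0 ≤ t → HasDerivWithinAt g 0 (Set.Ici 0) t) {t : ℝ} (ht : 0 ≤ t) :
    g t = g 0 :=
  (convex_Ici (0 : ℝ)).is_const_of_fderivWithin_eq_zero (𝕜 := ℝ)
    (fun τ hτ => (hg τ hτ).differentiableWithinAt)
    (fun τ hτ => by
      rw [(hg τ hτ).hasFDerivWithinAt.fderivWithin (uniqueDiffOn_Ici 0 τ hτ)]
      ext; simp) (Set.mem_Ici.mpr ht) (Set.mem_Ici.mpr le_rfl)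

/-- The `ℓ²` norm is conserved by the truncated system. -/
theorem sum_sq_eq_of_hasDerivWithinAt {N : ℕ} {v : ℝ → ℤ → ℂ}
    (hs : ∀ t, 0 ≤ t → ∀ k, v t (-k) = conj (v t k))
    (hsupp : ∀ t, 0 ≤ t → ∀ k : ℤ, (N : ℤ) < |k| → v t k = 0)
    (hv' : ∀ t, 0 ≤ t → ∀ k ∈ Finset.Icc (-(N : ℤ)) N,
      HasDerivWithinAt (fun τ => v τ k) (kawaharaRhs (v t) k) (Set.Ici 0) t) {t : ℝ}
    (ht : 0 ≤ t) :
    ∑ k ∈ Finset.Icc (-(N : ℤ)) N, ‖v t k‖ ^ 2 = ∑ k ∈ Finset.Icc (-(N : ℤ)) N, ‖v 0 k‖ ^ 2 := by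
  have hd : ∀ τ, 0 ≤ τ → HasDerivWithinAt (fun τ => ∑ k ∈ Finset.Icc (-(N : ℤ)) N, ‖v τ k‖ ^ 2)
      0 (Set.Ici 0) τ := fun τ hτ => by
    have h0 : ∑ k ∈ Finset.Icc (-(N : ℤ)) N, 2 * (conj (v τ k) * kawaharaRhs (v τ) k).re = 0 := by
      -- The energy identity against the zero sequence leaves only the cubic sum for v itself, which
      -- vanishes.
      have h := errorEnergyRate_eq N (v τ) 0
      unfold errorEnergyRate at h
      have hz : ∀ k, conv (0 : ℤ → ℂ) 0 k = 0 := fun k => by simp [conv]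
      simp only [kawaharaRhs, hz, Pi.zero_apply, sub_zero, mul_zero] at h
      rw [sum_conv_self_eq_zero (hsupp τ hτ) (hs τ hτ)] at h
      exact h
    refine HasDerivWithinAt.congr_deriv ?_ h0
    refine HasDerivWithinAt.fun_sum fun k hk => ?_
    have h := (hv' τ hτ k hk).norm_sq
    rw [Complex.inner, mul_comm (_ : ℂ) (conj _)] at h
    exact h
  exact eq_of_hasDerivWithinAt_zero hd ht

/-! ### Fourier coefficients: Parseval, inversion and products -/

/-- The Fourier coefficient of a complex-valued function. -/
def coef (F : ℝ → ℂ) (k : ℤ) : ℂ :=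
  (1 / (2 * Real.pi) : ℂ) *
    ∫ x in (-Real.pi)..Real.pi, Complex.exp (-(Complex.I * k * x)) * F x

theorem neg_pi_lt_pi : -Real.pi < Real.pi := by linarith [Real.pi_pos]

theorem coef_eq_fourierCoeffOn (F : ℝ → ℂ) (k : ℤ) :
    coef F k = fourierCoeffOn neg_pi_lt_pi F k := by
  rw [fourierCoeffOn_eq_integral, coef, Complex.real_smul]
  have hpi : (Real.pi : ℂ) ≠ 0 := by exact_mod_cast Real.pi_ne_zero
  congr 1
  · push_cast; ring
  · refine intervalIntegral.integral_congr fun x _ => ?_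
    simp only [fourier_coe_apply, smul_eq_mul]
    congr 2
    push_cast
    field_simp
    ring

theorem hasSum_sq_coef {F : ℝ → ℂ} (hF : MeasureTheory.MemLp F 2
    (MeasureTheory.volume.restrict (Set.Ioc (-Real.pi) Real.pi))) :
    HasSum (fun k => ‖coef F k‖ ^ 2)
      ((2 * Real.pi)⁻¹ * ∫ x in (-Real.pi)..Real.pi, ‖F x‖ ^ 2) := by
  have h := hasSum_sq_fourierCoeffOn neg_pi_lt_pi hF
  simp only [← coef_eq_fourierCoeffOn, smul_eq_mul] at h
  rwa [show Real.pi - -Real.pi = 2 * Real.pi by ring] at h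

theorem MemL2.memLp_ofReal {g : ℝ → ℝ} (hg : MemL2 g) :
    MeasureTheory.MemLp (fun x => (g x : ℂ)) 2
      (MeasureTheory.volume.restrict (Set.Ioc (-Real.pi) Real.pi)) := hg.memLp.ofReal

theorem hasSum_sq_fourierCoef {g : ℝ → ℝ} (hg : MemL2 g) :
    HasSum (fun k => ‖fourierCoef g k‖ ^ 2)
      ((2 * Real.pi)⁻¹ * ∫ x in (-Real.pi)..Real.pi, g x ^ 2) := by
  have h := hasSum_sq_coef hg.memLp_ofReal
  simp only [Complex.norm_real, Real.norm_eq_abs, sq_abs] at h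
  exact h

theorem fourierCoef_neg (g : ℝ → ℝ) (k : ℤ) : fourierCoef g (-k) = conj (fourierCoef g k) := by
  unfold fourierCoef
  rw [map_mul, intervalIntegral.integral_of_le neg_pi_lt_pi.le,
    intervalIntegral.integral_of_le neg_pi_lt_pi.le, ← integral_conj]
  congr 1
  · simp [map_ofNat]
  · congr 1
    funext x
    rw [map_mul, ← Complex.exp_conj, Complex.conj_ofReal]
    simp

theorem norm_exp_I_mul (k : ℤ) (x : ℝ) : ‖Complex.exp (Complex.I * k * x)‖ = 1 := by
  rw [show Complex.I * k * x = ((k * x : ℝ) : ℂ) * Complex.I by push_cast; ring,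
    Complex.norm_exp_ofReal_mul_I]

theorem norm_exp_neg_I_mul (k : ℤ) (x : ℝ) : ‖Complex.exp (-(Complex.I * k * x))‖ = 1 := by
  rw [Complex.exp_neg, norm_inv, norm_exp_I_mul, inv_one]

theorem coef_one (k : ℤ) : coef (fun _ => 1) k = if k = 0 then 1 else 0 := by
  have hpi : (Real.pi : ℂ) ≠ 0 := by exact_mod_cast Real.pi_ne_zero
  unfold coef
  split_ifs with h
  · subst h
    simp
    field_simp
    norm_num
  · have hk : -(Complex.I * k) ≠ 0 := by simp [h]
    have hi : ∫ x in (-Real.pi)..Real.pi, Complex.exp (-(Complex.I * k * x)) * 1 = 0 := by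
      have := integral_exp_mul_complex (a := -Real.pi) (b := Real.pi) hk
      simp only [mul_one]
      simp only [neg_mul] at this
      rw [this, div_eq_zero_iff, sub_eq_zero]
      left
      rw [Complex.exp_eq_exp_iff_exists_int]
      exact ⟨-k, by push_cast; ring⟩
    rw [hi, mul_zero]

/-- Fourier coefficients of the product of an absolutely convergent Fourier series with an
integrable function. -/
theorem coef_tsum_mul {c : ℤ → ℂ} (hc : Summable fun k => ‖c k‖) {H : ℝ → ℂ}
    (hH : MeasureTheory.IntegrableOn H (Set.Ioc (-Real.pi) Real.pi)) (k : ℤ) :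
    coef (fun x => (∑' j, c j * Complex.exp (Complex.I * j * x)) * H x) k = conv c (coef H) k := by
  have hcont : ∀ j : ℤ, Continuous fun x : ℝ =>
      Complex.exp (-(Complex.I * (k - j : ℤ) * x)) := fun j => by fun_prop
  have hint : ∀ j : ℤ, MeasureTheory.IntegrableOn
      (fun x : ℝ => Complex.exp (-(Complex.I * (k - j : ℤ) * x)) * H x)
      (Set.Ioc (-Real.pi) Real.pi) := fun j =>
    hH.bdd_mul (c := 1) (hcont j).aestronglyMeasurable
      (Filter.Eventually.of_forall fun x => (norm_exp_neg_I_mul _ x).le)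
  have hnorm : ∀ j : ℤ, ∫ x in Set.Ioc (-Real.pi) Real.pi,
      ‖c j * (Complex.exp (-(Complex.I * (k - j : ℤ) * x)) * H x)‖ =
      ‖c j‖ * ∫ x in Set.Ioc (-Real.pi) Real.pi, ‖H x‖ := fun j => by
    rw [← MeasureTheory.integral_const_mul]
    congr 1
    funext x
    rw [norm_mul, norm_mul, norm_exp_neg_I_mul, one_mul]
  -- The exponentials are unimodular, so the integrals of the norms are ‖c j‖ times a constant and
  -- termwise integration is justified.
  have hsum := MeasureTheory.hasSum_integral_of_summable_integral_norm
    (F := fun (j : ℤ) (x : ℝ) => c j * (Complex.exp (-(Complex.I * (k - j : ℤ) * x)) * H x))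
    (μ := MeasureTheory.volume.restrict (Set.Ioc (-Real.pi) Real.pi))
    (fun j => (hint j).const_mul _) (by simpa only [hnorm] using hc.mul_right _)
  have hpt : ∀ x : ℝ, ∑' j : ℤ, c j * (Complex.exp (-(Complex.I * (k - j : ℤ) * x)) * H x) =
      Complex.exp (-(Complex.I * k * x)) *
        ((∑' j, c j * Complex.exp (Complex.I * j * x)) * H x) := fun x => by
    rw [← tsum_mul_right, ← tsum_mul_left]
    refine tsum_congr fun j => ?_
    rw [show -(Complex.I * ((k - j : ℤ) : ℂ) * x) =
      -(Complex.I * k * x) + Complex.I * j * x by push_cast; ring, Complex.exp_add]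
    ring
  simp only [hpt] at hsum
  unfold coef
  rw [intervalIntegral.integral_of_le neg_pi_lt_pi.le, ← hsum.tsum_eq, ← tsum_mul_left, conv]
  refine tsum_congr fun j => ?_
  rw [MeasureTheory.integral_const_mul, intervalIntegral.integral_of_le neg_pi_lt_pi.le]
  ring

theorem conv_coef_one {c : ℤ → ℂ} (k : ℤ) : conv c (coef fun _ => 1) k = c k := by
  unfold conv
  rw [tsum_eq_single k fun j hj => by
    rw [coef_one, if_neg (sub_ne_zero.mpr hj.symm), mul_zero], coef_one]
  simp

/-- A square integrable function with absolutely summable Fourier coefficients is the sum of its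
Fourier series. -/
theorem ae_eq_tsum_coef {F : ℝ → ℂ} (hF : MeasureTheory.MemLp F 2
    (MeasureTheory.volume.restrict (Set.Ioc (-Real.pi) Real.pi)))
    (hc : Summable fun k => ‖coef F k‖) :
    F =ᵐ[MeasureTheory.volume.restrict (Set.Ioc (-Real.pi) Real.pi)]
      fun x => ∑' j, coef F j * Complex.exp (Complex.I * j * x) := by
  set G : ℝ → ℂ := fun x => ∑' j, coef F j * Complex.exp (Complex.I * j * x) with hG
  have hGc : Continuous G := by
    refine continuous_tsum (fun j => by fun_prop) hc fun j x => ?_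
    rw [norm_mul, norm_exp_I_mul, mul_one]
  have hGb : ∀ x, ‖G x‖ ≤ ∑' j, ‖coef F j‖ := fun x =>
    tsum_of_norm_bounded hc.hasSum fun j => by rw [norm_mul, norm_exp_I_mul, mul_one]
  have hGL : MeasureTheory.MemLp G 2
      (MeasureTheory.volume.restrict (Set.Ioc (-Real.pi) Real.pi)) :=
    MeasureTheory.MemLp.of_bound hGc.aestronglyMeasurable _ (Filter.Eventually.of_forall hGb)
  have hD := hF.sub hGL
  have hGcoef : ∀ k, coef G k = coef F k := fun k => by
    have := coef_tsum_mul hc (H := fun _ => 1) (by simp) k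
    simp only [mul_one] at this
    rw [hG, this, conv_coef_one]
  have hzero : ∀ k, coef (F - G) k = 0 := fun k => by
    have hi : ∀ {K : ℝ → ℂ}, MeasureTheory.MemLp K 2
        (MeasureTheory.volume.restrict (Set.Ioc (-Real.pi) Real.pi)) →
        IntervalIntegrable (fun x : ℝ => Complex.exp (-(Complex.I * k * x)) * K x)
          MeasureTheory.volume (-Real.pi) Real.pi := fun {K} hK => by
      rw [intervalIntegrable_iff_integrableOn_Ioc_of_le neg_pi_lt_pi.le]
      exact (hK.integrable one_le_two).bdd_mul (c := 1)
        (by fun_prop : Continuous fun x : ℝ =>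
          Complex.exp (-(Complex.I * k * x))).aestronglyMeasurable
        (Filter.Eventually.of_forall fun x => (norm_exp_neg_I_mul _ x).le)
    have := hGcoef k
    unfold coef at this ⊢
    simp only [Pi.sub_apply, mul_sub]
    rw [intervalIntegral.integral_sub (hi hF) (hi hGL), mul_sub, this, sub_self]
  -- Parseval for the difference: all its coefficients vanish, so its L² norm is zero.
  have hs := hasSum_sq_coef hD
  simp only [hzero, norm_zero, ne_eq, OfNat.ofNat_ne_zero, not_false_eq_true, zero_pow] at hs
  have h0 := hs.unique hasSum_zero
  rw [mul_eq_zero, or_iff_right (by positivity),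
    intervalIntegral.integral_of_le neg_pi_lt_pi.le,
    MeasureTheory.integral_eq_zero_iff_of_nonneg (fun _ => sq_nonneg _)
      ((MeasureTheory.memLp_two_iff_integrable_sq_norm hD.1).mp hD)] at h0
  filter_upwards [h0] with x hx
  have : ‖F x - G x‖ ^ 2 = 0 := hx
  rwa [sq_eq_zero_iff, norm_eq_zero, sub_eq_zero] at this

/-- The Fourier coefficients of a square are a convolution. -/
theorem coef_sq {F : ℝ → ℂ} (hF : MeasureTheory.MemLp F 2
    (MeasureTheory.volume.restrict (Set.Ioc (-Real.pi) Real.pi)))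
    (hc : Summable fun k => ‖coef F k‖) (k : ℤ) :
    coef (fun x => F x ^ 2) k = conv (coef F) (coef F) k := by
  rw [← coef_tsum_mul hc (hF.integrable one_le_two)]
  unfold coef
  congr 1
  rw [intervalIntegral.integral_of_le neg_pi_lt_pi.le,
    intervalIntegral.integral_of_le neg_pi_lt_pi.le]
  refine MeasureTheory.integral_congr_ae ?_
  filter_upwards [ae_eq_tsum_coef hF hc] with x hx
  have hx' : F x = ∑' j, coef F j * Complex.exp (Complex.I * j * x) := hx
  unfold coef at hx'
  rw [← hx', sq]

/-! ### Sobolev embedding and bounds on compact time intervals -/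

theorem summable_inv_one_add_sq : Summable fun k : ℤ => 2 / (1 + (k : ℝ) ^ 2) := by
  have h : Summable fun k : ℤ => 1 / |(k : ℝ)| ^ 2 :=
    (Real.summable_one_div_int_pow (p := 2)).mpr one_lt_two |>.congr fun k => by rw [sq_abs]
  -- At k = 0 the comparison series 1/|k|² has the default value 0, so the term 2 is added there
  -- separately.
  have h2 := (h.mul_left 2).add (summable_of_ne_finset_zero (s := {0})
    (f := fun k : ℤ => if k = 0 then (2 : ℝ) else 0) fun k hk => by simp_all)
  refine Summable.of_nonneg_of_le (fun k => by positivity) (fun k => ?_) h2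
  by_cases hk : k = 0
  · subst hk; simp
  · have : 0 < |(k : ℝ)| := abs_pos.mpr (Int.cast_ne_zero.mpr hk)
    rw [if_neg hk, add_zero, mul_one_div, ← sq_abs (k : ℝ)]
    gcongr
    linarith

/-- The constant in the embedding of `H^2` into the functions with absolutely summable
differentiated Fourier series. -/
def embeddingConst (M : ℝ) : ℝ := (M ^ 2 + ∑' k : ℤ, 2 / (1 + (k : ℝ) ^ 2)) / 2

/-- The pointwise form of Cauchy–Schwarz: (1+|k|)x splits as a square-summable weight times (1+k²)x,
and r ≥ 2 lets the H^r weight absorb the second square. -/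
theorem one_add_abs_mul_le {r : ℕ} (hr : 2 ≤ r) (k x : ℝ) :
    (1 + |k|) * x ≤ ((1 + k ^ 2) ^ r * x ^ 2 + 2 / (1 + k ^ 2)) / 2 := by
  have h1 : (1 : ℝ) ≤ 1 + k ^ 2 := by nlinarith
  have h2 : (1 + k ^ 2) ^ 2 ≤ (1 + k ^ 2) ^ r := pow_le_pow_right₀ h1 hr
  have h3 : (1 + k ^ 2) ^ 2 * x ^ 2 ≤ (1 + k ^ 2) ^ r * x ^ 2 := by gcongr
  have h4 : 2 * ((1 + |k|) * x) ≤ (1 + k ^ 2) ^ 2 * x ^ 2 + 2 / (1 + k ^ 2) := by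
    have h5 : (1 + |k|) ^ 2 ≤ 2 * (1 + k ^ 2) := by nlinarith [sq_abs k, sq_nonneg (1 - |k|)]
    have h6 : ((1 + |k|) / (1 + k ^ 2)) ^ 2 ≤ 2 / (1 + k ^ 2) := by
      rw [div_pow, div_le_div_iff₀ (by positivity) (by positivity)]
      nlinarith
    have h7 : (1 + |k|) * x = ((1 + |k|) / (1 + k ^ 2)) * ((1 + k ^ 2) * x) := by
      field_simp
    rw [h7]
    nlinarith [sq_nonneg ((1 + |k|) / (1 + k ^ 2) - (1 + k ^ 2) * x)]
  linarith

/-- The resulting bounds depend only on M, so a bound on the H^r norm that is uniform in time gives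
constants uniform in time. -/
theorem MemH.sobolevBound {r : ℕ} (hr : 2 ≤ r) {g : ℝ → ℝ} (hg : MemH r g) {M : ℝ}
    (hM : hNorm r g ≤ M) : SobolevBound r (embeddingConst M) M (fourierCoef g) := by
  have h0 : 0 ≤ ∑' k : ℤ, (1 + (k : ℝ) ^ 2) ^ r * ‖fourierCoef g k‖ ^ 2 :=
    tsum_nonneg fun _ => by positivity
  have hsq : ∑' k : ℤ, (1 + (k : ℝ) ^ 2) ^ r * ‖fourierCoef g k‖ ^ 2 ≤ M ^ 2 :=
    (Real.sqrt_le_iff.mp hM).2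
  have hle := fun k : ℤ => one_add_abs_mul_le hr k ‖fourierCoef g k‖
  have hs := (hg.summable.add summable_inv_one_add_sq).div_const 2
  have hs' := Summable.of_nonneg_of_le (fun k : ℤ => by positivity) hle hs
  refine ⟨fourierCoef_neg g, hs', (hs'.tsum_le_tsum hle hs).trans ?_, hg.summable, hsq⟩
  rw [tsum_div_const, hg.summable.tsum_add summable_inv_one_add_sq]
  unfold embeddingConst
  gcongr

theorem integrableOn_ofReal {g : ℝ → ℝ} {S : Set ℝ} (hg : MeasureTheory.IntegrableOn g S) :
    MeasureTheory.IntegrableOn (fun x => (g x : ℂ)) S := MeasureTheory.Integrable.ofReal hg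

theorem intervalIntegrable_ofReal {g : ℝ → ℝ} {a b : ℝ}
    (hg : IntervalIntegrable g MeasureTheory.volume a b) :
    IntervalIntegrable (fun x => (g x : ℂ)) MeasureTheory.volume a b :=
  ⟨integrableOn_ofReal hg.1, integrableOn_ofReal hg.2⟩

theorem intervalIntegrable_exp_mul {F : ℝ → ℂ} (hF : MeasureTheory.IntegrableOn F
    (Set.Ioc (-Real.pi) Real.pi)) (k : ℤ) :
    IntervalIntegrable (fun x : ℝ => Complex.exp (-(Complex.I * k * x)) * F x)
      MeasureTheory.volume (-Real.pi) Real.pi := by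
  rw [intervalIntegrable_iff_integrableOn_Ioc_of_le neg_pi_lt_pi.le]
  exact hF.bdd_mul (c := 1)
    (by fun_prop : Continuous fun x : ℝ =>
      Complex.exp (-(Complex.I * k * x))).aestronglyMeasurable
    (Filter.Eventually.of_forall fun x => (norm_exp_neg_I_mul _ x).le)

theorem MemL2.integrableOn {g : ℝ → ℝ} (hg : MemL2 g) :
    MeasureTheory.IntegrableOn g (Set.Ioc (-Real.pi) Real.pi) := hg.memLp.integrable one_le_two

theorem MemL2.sub {g h : ℝ → ℝ} (hg : MemL2 g) (hh : MemL2 h) : MemL2 fun x => g x - h x :=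
  ⟨hg.periodic.sub hh.periodic, hg.memLp.sub hh.memLp⟩

theorem fourierCoef_sub {g h : ℝ → ℝ} (hg : MemL2 g) (hh : MemL2 h) (k : ℤ) :
    fourierCoef (fun x => g x - h x) k = fourierCoef g k - fourierCoef h k := by
  unfold fourierCoef
  simp only [Complex.ofReal_sub, mul_sub]
  rw [intervalIntegral.integral_sub
    (intervalIntegrable_exp_mul (integrableOn_ofReal hg.integrableOn) k)
    (intervalIntegrable_exp_mul (integrableOn_ofReal hh.integrableOn) k), mul_sub]

/-- A weak triangle inequality, from |x+y|² ≤ 2|x|² + 2|y|² on each coefficient; this suffices for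
local boundedness. -/
theorem hNorm_sq_le {r : ℕ} {g h : ℝ → ℝ} (hg : MemH r g) (hh : MemH r h) :
    hNorm r g ^ 2 ≤ 2 * hNorm r h ^ 2 + 2 * hNorm r (fun x => g x - h x) ^ 2 := by
  have hle : ∀ k : ℤ, (1 + (k : ℝ) ^ 2) ^ r * ‖fourierCoef (fun x => g x - h x) k‖ ^ 2 ≤
      2 * ((1 + (k : ℝ) ^ 2) ^ r * ‖fourierCoef g k‖ ^ 2) +
      2 * ((1 + (k : ℝ) ^ 2) ^ r * ‖fourierCoef h k‖ ^ 2) := fun k => by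
    rw [fourierCoef_sub hg.memL2 hh.memL2]
    have h1 := norm_sub_le (fourierCoef g k) (fourierCoef h k)
    have h2 : ‖fourierCoef g k - fourierCoef h k‖ ^ 2 ≤
        2 * ‖fourierCoef g k‖ ^ 2 + 2 * ‖fourierCoef h k‖ ^ 2 := by
      nlinarith [norm_nonneg (fourierCoef g k - fourierCoef h k),
        sq_nonneg (‖fourierCoef g k‖ - ‖fourierCoef h k‖)]
    have h3 := mul_le_mul_of_nonneg_left h2 (by positivity : 0 ≤ (1 + (k : ℝ) ^ 2) ^ r)
    linarith
  have hd := Summable.of_nonneg_of_le (fun k : ℤ => by positivity) hle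
    ((hg.summable.mul_left 2).add (hh.summable.mul_left 2))
  have hle' : ∀ k : ℤ, (1 + (k : ℝ) ^ 2) ^ r * ‖fourierCoef g k‖ ^ 2 ≤
      2 * ((1 + (k : ℝ) ^ 2) ^ r * ‖fourierCoef h k‖ ^ 2) +
      2 * ((1 + (k : ℝ) ^ 2) ^ r * ‖fourierCoef (fun x => g x - h x) k‖ ^ 2) := fun k => by
    rw [fourierCoef_sub hg.memL2 hh.memL2]
    have h1 := norm_add_le (fourierCoef h k) (fourierCoef g k - fourierCoef h k)
    rw [add_sub_cancel] at h1
    have h2 : ‖fourierCoef g k‖ ^ 2 ≤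
        2 * ‖fourierCoef h k‖ ^ 2 + 2 * ‖fourierCoef g k - fourierCoef h k‖ ^ 2 := by
      nlinarith [norm_nonneg (fourierCoef g k),
        sq_nonneg (‖fourierCoef h k‖ - ‖fourierCoef g k - fourierCoef h k‖)]
    have h3 := mul_le_mul_of_nonneg_left h2 (by positivity : 0 ≤ (1 + (k : ℝ) ^ 2) ^ r)
    linarith
  unfold hNorm
  rw [Real.sq_sqrt (tsum_nonneg fun _ => by positivity),
    Real.sq_sqrt (tsum_nonneg fun _ => by positivity),
    Real.sq_sqrt (tsum_nonneg fun _ => by positivity)]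
  refine (hg.summable.tsum_le_tsum hle'
    ((hh.summable.mul_left 2).add (hd.mul_left 2))).trans_eq ?_
  rw [(hh.summable.mul_left 2).tsum_add (hd.mul_left 2), tsum_mul_left, tsum_mul_left]

/-- A solution in `C([0, ∞); H^r)` is bounded in `H^r` on compact time intervals. -/
theorem IsKawaharaSolution.exists_hNorm_le {r : ℕ} {f : ℝ → ℝ} {u : ℝ → ℝ → ℝ}
    (hu : IsKawaharaSolution r f u) (T : ℝ) :
    ∃ M, 0 ≤ M ∧ ∀ t ∈ Set.Icc 0 T, hNorm r (u t) ≤ M := by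
  refine isCompact_Icc.induction_on (p := fun S => ∃ M, 0 ≤ M ∧ ∀ t ∈ S, hNorm r (u t) ≤ M)
    ⟨0, le_rfl, fun t ht => ht.elim⟩ (fun S S' hS ⟨M, hM, h⟩ => ⟨M, hM, fun t ht => h t (hS ht)⟩)
    (fun S S' ⟨M, hM, h⟩ ⟨M', hM', h'⟩ => ⟨M + M', by positivity, fun t ht => ?_⟩) fun t ht => ?_
  · rcases ht with ht | ht
    · linarith [h t ht]
    · linarith [h' t ht]
  · have hev := (hu.continuous t ht.1).eventually (gt_mem_nhds one_pos)
    rw [eventually_nhdsWithin_iff] at hev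
    -- Near t the solution stays within distance 1 of u(t), so its squared norm is at most 2‖u(t)‖²
    -- + 2 ≤ (2‖u(t)‖ + 2)². Compactness assembles finitely many such bounds.
    refine ⟨{s | s ∈ Set.Ici 0 → hNorm r (fun x => u s x - u t x) < 1} ∩ Set.Icc 0 T,
      Filter.inter_mem (mem_nhdsWithin_of_mem_nhds hev) self_mem_nhdsWithin,
      2 * hNorm r (u t) + 2, by unfold hNorm; positivity, fun s hs => ?_⟩
    have h1 := hs.1 hs.2.1
    have h2 := hNorm_sq_le (hu.mem s hs.2.1) (hu.mem t ht.1)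
    have h3 : 0 ≤ hNorm r (u t) := Real.sqrt_nonneg _
    have h4 : 0 ≤ hNorm r (fun x => u s x - u t x) := Real.sqrt_nonneg _
    refine abs_le_of_sq_le_sq' ?_ (by positivity) |>.2
    nlinarith

/-! ### From the weak equation to the system for the coefficients -/

theorem iteratedDeriv_three_cos : iteratedDeriv 3 Real.cos = Real.sin := by
  funext x; simp [iteratedDeriv_succ, iteratedDeriv_zero]

theorem iteratedDeriv_five_cos : iteratedDeriv 5 Real.cos = fun x => -Real.sin x := by
  funext x; simp [iteratedDeriv_succ, iteratedDeriv_zero]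

theorem iteratedDeriv_three_sin : iteratedDeriv 3 Real.sin = fun x => -Real.cos x := by
  funext x; simp [iteratedDeriv_succ, iteratedDeriv_zero]

theorem iteratedDeriv_five_sin : iteratedDeriv 5 Real.sin = Real.cos := by
  funext x; simp [iteratedDeriv_succ, iteratedDeriv_zero]

theorem exp_neg_I_mul (k : ℤ) (x : ℝ) : Complex.exp (-(Complex.I * k * x)) =
    (Real.cos (k * x) : ℂ) - Complex.I * Real.sin (k * x) := by
  rw [show -(Complex.I * k * x) = (-(k * x : ℂ)) * Complex.I by ring, Complex.exp_mul_I,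
    Complex.cos_neg, Complex.sin_neg]
  push_cast
  ring

theorem periodic_comp_int_mul {φ : ℝ → ℝ} (hφ : Function.Periodic φ (2 * Real.pi)) (k : ℤ) :
    Function.Periodic (fun x => φ (k * x)) (2 * Real.pi) := fun x => by
  change φ (k * (x + 2 * Real.pi)) = φ (k * x)
  rw [mul_add]
  exact hφ.int_mul k (k * x)

theorem intervalIntegrable_mul_continuous {g φ : ℝ → ℝ} (hg : MeasureTheory.IntegrableOn g
    (Set.Ioc (-Real.pi) Real.pi)) (hφ : Continuous φ) :
    IntervalIntegrable (fun x => g x * φ x) MeasureTheory.volume (-Real.pi) Real.pi :=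
  ((intervalIntegrable_iff_integrableOn_Ioc_of_le neg_pi_lt_pi.le).mpr hg).mul_continuousOn
    hφ.continuousOn

theorem fourierCoef_eq_cos_sin {g : ℝ → ℝ} (hg : MeasureTheory.IntegrableOn g
    (Set.Ioc (-Real.pi) Real.pi)) (k : ℤ) :
    fourierCoef g k = (1 / (2 * Real.pi) : ℂ) *
      (((∫ x in (-Real.pi)..Real.pi, g x * Real.cos (k * x) : ℝ) : ℂ) -
        Complex.I * ((∫ x in (-Real.pi)..Real.pi, g x * Real.sin (k * x) : ℝ) : ℂ)) := by
  have h1 := intervalIntegrable_mul_continuous hg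
    (by fun_prop : Continuous fun x : ℝ => Real.cos (k * x))
  have h2 := intervalIntegrable_mul_continuous hg
    (by fun_prop : Continuous fun x : ℝ => Real.sin (k * x))
  unfold fourierCoef
  rw [← intervalIntegral.integral_ofReal, ← intervalIntegral.integral_ofReal,
    ← intervalIntegral.integral_const_mul Complex.I,
    ← intervalIntegral.integral_sub (intervalIntegrable_ofReal h1)
    ((intervalIntegrable_ofReal h2).const_mul _)]
  congr 1
  refine intervalIntegral.integral_congr fun x _ => ?_
  simp only [exp_neg_I_mul]
  push_cast
  ring

/-- The Fourier coefficients of a solution of the Kawahara equation solve a system of ordinary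
differential equations. -/
theorem IsKawaharaSolution.hasDerivWithinAt {r : ℕ} (hr : 2 ≤ r) {f : ℝ → ℝ} {u : ℝ → ℝ → ℝ}
    (hu : IsKawaharaSolution r f u) {t : ℝ} (ht : 0 ≤ t) (k : ℤ) :
    HasDerivWithinAt (fun s => fourierCoef (u s) k) (kawaharaRhs (fourierCoef (u t)) k)
      (Set.Ici 0) t := by
  have hm := hu.mem t ht
  have hi := hm.memL2.integrableOn
  have hsq : MeasureTheory.IntegrableOn (fun x => u t x ^ 2) (Set.Ioc (-Real.pi) Real.pi) :=
    hm.memL2.memLp.integrable_sq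
  have hconv : fourierCoef (fun x => u t x ^ 2) k =
      conv (fourierCoef (u t)) (fourierCoef (u t)) k := by
    have h := coef_sq hm.memL2.memLp_ofReal (hm.sobolevBound hr le_rfl).summable_norm k
    refine Eq.trans ?_ h
    unfold fourierCoef coef
    simp only [Complex.ofReal_pow]
  have hcs : ∀ n : WithTop ℕ∞, ContDiff ℝ n fun x : ℝ => Real.cos (k * x) := fun n =>
    Real.contDiff_cos.comp (contDiff_const.mul contDiff_id)
  have hsn : ∀ n : WithTop ℕ∞, ContDiff ℝ n fun x : ℝ => Real.sin (k * x) := fun n =>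
    Real.contDiff_sin.comp (contDiff_const.mul contDiff_id)
  -- The test functions are real, so cos(kx) and sin(kx) are tested separately and recombined into
  -- e^{-ikx}.
  have hc := hu.equation (fun x => Real.cos (k * x)) (hcs _)
    (periodic_comp_int_mul Real.cos_periodic k) t ht
  have hs := hu.equation (fun x => Real.sin (k * x)) (hsn _)
    (periodic_comp_int_mul Real.sin_periodic k) t ht
  rw [iteratedDeriv_comp_const_mul Real.contDiff_cos, iteratedDeriv_comp_const_mul
    Real.contDiff_cos, iteratedDeriv_three_cos, iteratedDeriv_five_cos] at hc
  rw [iteratedDeriv_comp_const_mul Real.contDiff_sin, iteratedDeriv_comp_const_mul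
    Real.contDiff_sin, iteratedDeriv_three_sin, iteratedDeriv_five_sin] at hs
  have hdc : deriv (fun x : ℝ => Real.cos (k * x)) = fun x : ℝ => -(k * Real.sin (k * x)) := by
    funext x
    have h := ((hasDerivAt_id x).const_mul (k : ℝ)).cos
    simp only [id, mul_one] at h
    rw [h.deriv]; ring
  have hds : deriv (fun x : ℝ => Real.sin (k * x)) = fun x : ℝ => k * Real.cos (k * x) := by
    funext x
    have h := ((hasDerivAt_id x).const_mul (k : ℝ)).sin
    simp only [id, mul_one] at h
    rw [h.deriv]; ring
  rw [hdc] at hc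
  rw [hds] at hs
  have ic := intervalIntegrable_mul_continuous hi
    (by fun_prop : Continuous fun x : ℝ => Real.cos (k * x))
  have is := intervalIntegrable_mul_continuous hi
    (by fun_prop : Continuous fun x : ℝ => Real.sin (k * x))
  have ic2 := intervalIntegrable_mul_continuous hsq
    (by fun_prop : Continuous fun x : ℝ => Real.cos (k * x))
  have is2 := intervalIntegrable_mul_continuous hsq
    (by fun_prop : Continuous fun x : ℝ => Real.sin (k * x))
  have ec : (∫ x in (-Real.pi)..Real.pi, (u t x ^ 2 / 2 * -(k * Real.sin (k * x)) +
      u t x * ((k : ℝ) ^ 3 * Real.sin (k * x)) - u t x * ((k : ℝ) ^ 5 * -Real.sin (k * x)))) =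
      omega k * (∫ x in (-Real.pi)..Real.pi, u t x * Real.sin (k * x)) -
        k / 2 * ∫ x in (-Real.pi)..Real.pi, u t x ^ 2 * Real.sin (k * x) := by
    rw [← intervalIntegral.integral_const_mul, ← intervalIntegral.integral_const_mul,
      ← intervalIntegral.integral_sub (is.const_mul _) (is2.const_mul _)]
    congr 1
    funext x
    unfold omega
    ring
  have es : (∫ x in (-Real.pi)..Real.pi, (u t x ^ 2 / 2 * (k * Real.cos (k * x)) +
      u t x * ((k : ℝ) ^ 3 * -Real.cos (k * x)) - u t x * ((k : ℝ) ^ 5 * Real.cos (k * x)))) =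
      k / 2 * (∫ x in (-Real.pi)..Real.pi, u t x ^ 2 * Real.cos (k * x)) -
        omega k * ∫ x in (-Real.pi)..Real.pi, u t x * Real.cos (k * x) := by
    rw [← intervalIntegral.integral_const_mul, ← intervalIntegral.integral_const_mul,
      ← intervalIntegral.integral_sub (ic2.const_mul _) (ic.const_mul _)]
    congr 1
    funext x
    unfold omega
    ring
  rw [ec] at hc
  rw [es] at hs
  have hd := (hc.ofReal_comp.sub (hs.ofReal_comp.const_mul Complex.I)).const_mul
    (1 / (2 * Real.pi) : ℂ)
  refine (hd.congr (fun s hs => ?_) ?_).congr_deriv ?_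
  · exact fourierCoef_eq_cos_sin (hu.mem s hs).memL2.integrableOn k
  · exact fourierCoef_eq_cos_sin hi k
  · unfold kawaharaRhs
    rw [← hconv, fourierCoef_eq_cos_sin hi, fourierCoef_eq_cos_sin hsq]
    push_cast
    linear_combination ((1 / (2 * Real.pi) : ℂ) * (omega k * (∫ x in (-Real.pi)..Real.pi,
      u t x * Real.sin (k * x) : ℝ) - k / 2 * (∫ x in (-Real.pi)..Real.pi,
      u t x ^ 2 * Real.sin (k * x) : ℝ))) * Complex.I_sq

/-! ### Trigonometric polynomials and the residual of the scheme -/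

/-- The trigonometric polynomial with coefficients `c`. -/
def trigPoly (N : ℕ) (c : ℤ → ℂ) (x : ℝ) : ℂ :=
  ∑ k ∈ Finset.Icc (-(N : ℤ)) N, c k * Complex.exp (Complex.I * k * x)

theorem continuous_trigPoly (N : ℕ) (c : ℤ → ℂ) : Continuous (trigPoly N c) := by
  unfold trigPoly; fun_prop

theorem exp_mem_trigSpace {N : ℕ} {k : ℤ} (hk : k ∈ Finset.Icc (-(N : ℤ)) N) :
    (fun x : ℝ => Complex.exp (Complex.I * k * x)) ∈ trigSpace N :=
  Submodule.subset_span ⟨k, (Finset.mem_Icc.mp hk).1, (Finset.mem_Icc.mp hk).2, rfl⟩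

theorem trigPoly_mem (N : ℕ) (c : ℤ → ℂ) : trigPoly N c ∈ trigSpace N := by
  have h : trigPoly N c = ∑ k ∈ Finset.Icc (-(N : ℤ)) N,
      c k • fun x : ℝ => Complex.exp (Complex.I * k * x) := by
    funext x; simp [trigPoly]
  rw [h]
  exact Submodule.sum_mem _ fun k hk => Submodule.smul_mem _ _ (exp_mem_trigSpace hk)

theorem exists_eq_trigPoly {N : ℕ} {F : ℝ → ℂ} (hF : F ∈ trigSpace N) :
    ∃ c, F = trigPoly N c := by
  induction hF using Submodule.span_induction with
  | mem F h =>
    obtain ⟨k, h1, h2, rfl⟩ := h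
    refine ⟨fun j => if j = k then 1 else 0, ?_⟩
    funext x
    simp [trigPoly, h1, h2]
  | zero => exact ⟨0, by funext x; simp [trigPoly]⟩
  | add F G _ _ hF hG =>
    obtain ⟨c, rfl⟩ := hF
    obtain ⟨d, rfl⟩ := hG
    exact ⟨c + d, by funext x; simp [trigPoly, add_mul, Finset.sum_add_distrib]⟩
  | smul a F _ hF =>
    obtain ⟨c, rfl⟩ := hF
    exact ⟨a • c, by funext x; simp [trigPoly, Finset.mul_sum, mul_assoc]⟩

theorem coef_trigPoly_mul {N : ℕ} {c : ℤ → ℂ} (hc : ∀ k : ℤ, (N : ℤ) < |k| → c k = 0)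
    {H : ℝ → ℂ} (hH : MeasureTheory.IntegrableOn H (Set.Ioc (-Real.pi) Real.pi)) (k : ℤ) :
    coef (fun x => trigPoly N c x * H x) k = conv c (coef H) k := by
  rw [← coef_tsum_mul (hasSum_of_support hc (f := norm) norm_zero).summable hH]
  congr 1
  funext x
  rw [tsum_eq_sum (s := Finset.Icc (-(N : ℤ)) N) fun j hj => by
    rw [hc j (not_mem_Icc_iff.mp hj), zero_mul]]
  rfl

theorem coef_trigPoly_of_support {N : ℕ} {c : ℤ → ℂ} (hc : ∀ k : ℤ, (N : ℤ) < |k| → c k = 0)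
    (k : ℤ) : coef (trigPoly N c) k = c k := by
  have h := coef_trigPoly_mul hc (H := fun _ => 1) (by simp) k
  rw [conv_coef_one] at h
  simpa only [mul_one] using h

theorem trigPoly_head (N : ℕ) (c : ℤ → ℂ) : trigPoly N (head N c) = trigPoly N c := by
  funext x
  exact Finset.sum_congr rfl fun k hk => by rw [head_of_mem c hk]

theorem coef_trigPoly (N : ℕ) (c : ℤ → ℂ) (k : ℤ) : coef (trigPoly N c) k = head N c k := by
  rw [← trigPoly_head]
  exact coef_trigPoly_of_support (fun k hk => if_pos hk) k

theorem eq_trigPoly_coef {N : ℕ} {F : ℝ → ℂ} (hF : F ∈ trigSpace N) :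
    F = trigPoly N (coef F) := by
  obtain ⟨c, rfl⟩ := exists_eq_trigPoly hF
  rw [← trigPoly_head]
  congr 1
  funext k
  rw [trigPoly_head, coef_trigPoly]

theorem coef_eq_zero_of_mem {N : ℕ} {F : ℝ → ℂ} (hF : F ∈ trigSpace N) {k : ℤ}
    (hk : (N : ℤ) < |k|) : coef F k = 0 := by
  obtain ⟨c, rfl⟩ := exists_eq_trigPoly hF
  rw [coef_trigPoly, head, if_pos hk]

theorem l2Inner_exp (F : ℝ → ℂ) (k : ℤ) :
    l2Inner F (fun x => Complex.exp (Complex.I * k * x)) = 2 * Real.pi * coef F k := by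
  have hpi : (Real.pi : ℂ) ≠ 0 := by exact_mod_cast Real.pi_ne_zero
  unfold l2Inner coef
  rw [← mul_assoc, mul_one_div_cancel (by simp [hpi]), one_mul]
  refine intervalIntegral.integral_congr fun x _ => ?_
  simp only [← Complex.exp_conj, map_mul, Complex.conj_I, Complex.conj_ofReal, map_intCast]
  rw [mul_comm, neg_mul, neg_mul]

theorem l2Inner_eq_zero_of_coef {N : ℕ} {F : ℝ → ℂ}
    (hF : MeasureTheory.IntegrableOn F (Set.Ioc (-Real.pi) Real.pi))
    (h : ∀ k ∈ Finset.Icc (-(N : ℤ)) N, coef F k = 0) {φ : ℝ → ℂ} (hφ : φ ∈ trigSpace N) :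
    l2Inner F φ = 0 := by
  obtain ⟨c, rfl⟩ := exists_eq_trigPoly hφ
  have hk : ∀ k ∈ Finset.Icc (-(N : ℤ)) N, ∫ x in (-Real.pi)..Real.pi,
      conj (c k) * (Complex.exp (-(Complex.I * k * x)) * F x) = 0 := fun k hk => by
    have hpi : (Real.pi : ℂ) ≠ 0 := by exact_mod_cast Real.pi_ne_zero
    have := h k hk
    unfold coef at this
    rw [mul_eq_zero, or_iff_right (by simp [hpi])] at this
    rw [intervalIntegral.integral_const_mul, this, mul_zero]
  unfold l2Inner
  rw [← Finset.sum_eq_zero hk, ← intervalIntegral.integral_finsetSum fun k _ =>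
    (intervalIntegrable_exp_mul hF k).const_mul _]
  refine intervalIntegral.integral_congr fun x _ => ?_
  simp only [trigPoly, map_sum, Finset.mul_sum, map_mul, ← Complex.exp_conj, Complex.conj_I,
    Complex.conj_ofReal, map_intCast, neg_mul]
  exact Finset.sum_congr rfl fun k _ => by ring

theorem hasDerivAt_trigPoly (N : ℕ) (c : ℤ → ℂ) (x : ℝ) :
    HasDerivAt (trigPoly N c) (trigPoly N (fun k => Complex.I * k * c k) x) x := by
  unfold trigPoly
  refine HasDerivAt.fun_sum fun k _ => ?_
  have h := (((hasDerivAt_id x).ofReal_comp.const_mul (Complex.I * k)).cexp).const_mul (c k)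
  simp only [id] at h
  refine h.congr_deriv ?_
  push_cast
  ring

/-- Taking real parts differentiates g; uniqueness of the derivative then shows that the complex
derivative is itself real. -/
theorem hasDerivWithinAt_of_ofReal {g : ℝ → ℝ} {G : ℝ → ℂ} {G' : ℂ} {s : Set ℝ} {x : ℝ}
    (hx : x ∈ s) (hs : UniqueDiffWithinAt ℝ s x) (hg : ∀ y ∈ s, (g y : ℂ) = G y)
    (hG : HasDerivWithinAt G G' s x) :
    HasDerivWithinAt g G'.re s x ∧ (G'.re : ℂ) = G' := by
  have h1 : HasDerivWithinAt g G'.re s x := by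
    have := Complex.reCLM.hasFDerivAt.comp_hasDerivWithinAt x hG
    refine this.congr (fun y hy => ?_) ?_
    · simp [← hg y hy]
    · simp [← hg x hx]
  refine ⟨h1, ?_⟩
  have h2 := h1.ofReal_comp.congr (f₁ := G) (fun y hy => (hg y hy).symm) (hg x hx).symm
  exact hs.eq_deriv _ h2 hG

theorem ofReal_iteratedDeriv {N : ℕ} {c : ℤ → ℂ} {g : ℝ → ℝ}
    (hg : ∀ x, (g x : ℂ) = trigPoly N c x) (n : ℕ) (x : ℝ) :
    ((iteratedDeriv n g x : ℝ) : ℂ) = trigPoly N (fun k => (Complex.I * k) ^ n * c k) x := by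
  induction n generalizing x with
  | zero => simpa using hg x
  | succ n ih =>
    have h := hasDerivWithinAt_of_ofReal (Set.mem_univ x) uniqueDiffWithinAt_univ
      (fun y _ => ih y) (hasDerivAt_trigPoly N _ x).hasDerivWithinAt
    rw [iteratedDeriv_succ, (hasDerivWithinAt_univ.mp h.1).deriv, h.2]
    congr 1
    funext k
    ring

/-- The identity uu_x = (u²)_x/2: by commutativity the derivative may fall on either factor, and by
Leibniz the two placements sum to ik times the convolution. -/
theorem conv_deriv {N : ℕ} {c : ℤ → ℂ} (hc : ∀ k : ℤ, (N : ℤ) < |k| → c k = 0) (k : ℤ) :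
    conv c (fun j => Complex.I * j * c j) k = Complex.I * k / 2 * conv c c k := by
  have hs : ∀ d : ℤ → ℂ, Summable fun j => c j * d j := fun d =>
    summable_of_ne_finset_zero (s := Finset.Icc (-(N : ℤ)) N) fun j hj => by
      rw [hc j (not_mem_Icc_iff.mp hj), zero_mul]
  have h1 : conv c (fun j => Complex.I * j * c j) k +
      conv (fun j => Complex.I * j * c j) c k = Complex.I * k * conv c c k := by
    unfold conv
    rw [← (hs _).tsum_add ((hs fun j => Complex.I * j * c (k - j)).congr fun j => by ring),
      ← tsum_mul_left]
    refine tsum_congr fun j => ?_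
    push_cast
    ring
  rw [conv_comm _ c] at h1
  linear_combination h1 / 2

theorem trigPoly_add (N : ℕ) (c d : ℤ → ℂ) (x : ℝ) :
    trigPoly N c x + trigPoly N d x = trigPoly N (fun k => c k + d k) x := by
  simp only [trigPoly, ← Finset.sum_add_distrib, add_mul]

theorem trigPoly_sub (N : ℕ) (c d : ℤ → ℂ) (x : ℝ) :
    trigPoly N c x - trigPoly N d x = trigPoly N (fun k => c k - d k) x := by
  simp only [trigPoly, ← Finset.sum_sub_distrib, sub_mul]

theorem integrableOn_of_continuous {F : ℝ → ℂ} (hF : Continuous F) :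
    MeasureTheory.IntegrableOn F (Set.Ioc (-Real.pi) Real.pi) :=
  hF.continuousOn.integrableOn_Icc.mono_set Set.Ioc_subset_Icc_self

theorem coef_add {F G : ℝ → ℂ} (hF : MeasureTheory.IntegrableOn F (Set.Ioc (-Real.pi) Real.pi))
    (hG : MeasureTheory.IntegrableOn G (Set.Ioc (-Real.pi) Real.pi)) (k : ℤ) :
    coef (fun x => F x + G x) k = coef F k + coef G k := by
  unfold coef
  simp only [mul_add]
  rw [intervalIntegral.integral_add (intervalIntegrable_exp_mul hF k)
    (intervalIntegrable_exp_mul hG k), mul_add]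

section Residual

variable {N : ℕ} {U : ℝ → ℝ → ℝ} {V : ℝ → ℤ → ℂ} {V' : ℤ → ℂ} {t : ℝ}

theorem ofReal_residual (ht : 0 ≤ t) (hU : ∀ s, 0 ≤ s → ∀ x, (U s x : ℂ) = trigPoly N (V s) x)
    (hV : ∀ k ∈ Finset.Icc (-(N : ℤ)) N,
      HasDerivWithinAt (fun s => V s k) (V' k) (Set.Ici 0) t) (x : ℝ) :
    (residual U t x : ℂ) = trigPoly N (V t) x * trigPoly N (fun k => Complex.I * k * V t k) x +
      trigPoly N (fun k => V' k - Complex.I * omega k * V t k) x := by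
  have hd : HasDerivWithinAt (fun s => trigPoly N (V s) x) (trigPoly N V' x) (Set.Ici 0) t := by
    unfold trigPoly
    exact HasDerivWithinAt.fun_sum fun k hk => (hV k hk).mul_const _
  have hu := uniqueDiffOn_Ici (0 : ℝ) t ht
  have h := hasDerivWithinAt_of_ofReal (Set.mem_Ici.mpr ht) hu
    (fun s hs => hU s hs x) hd
  have h1 := ofReal_iteratedDeriv (hU t ht) 1 x
  rw [iteratedDeriv_one] at h1
  unfold residual
  rw [h.1.derivWithin hu]
  push_cast
  rw [h.2, h1, ofReal_iteratedDeriv (hU t ht), ofReal_iteratedDeriv (hU t ht), hU t ht]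
  have e : trigPoly N (fun k => V' k - Complex.I * omega k * V t k) x =
      trigPoly N V' x + trigPoly N (fun k => (Complex.I * k) ^ 3 * V t k) x -
        trigPoly N (fun k => (Complex.I * k) ^ 5 * V t k) x := by
    rw [trigPoly_add, trigPoly_sub]
    congr 1
    funext k
    unfold omega
    push_cast
    linear_combination (Complex.I * (Complex.I ^ 2 - 1) * k ^ 5 * V t k) * Complex.I_sq -
      (Complex.I * k ^ 3 * V t k) * Complex.I_sq
  rw [e]
  simp only [pow_one]
  ring

/-- Reduces the Galerkin condition to one ordinary differential equation per frequency |k| ≤ N. -/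
theorem coef_residual (ht : 0 ≤ t) (hU : ∀ s, 0 ≤ s → ∀ x, (U s x : ℂ) = trigPoly N (V s) x)
    (hs : ∀ k : ℤ, (N : ℤ) < |k| → V t k = 0)
    (hV : ∀ k ∈ Finset.Icc (-(N : ℤ)) N,
      HasDerivWithinAt (fun s => V s k) (V' k) (Set.Ici 0) t) {k : ℤ}
    (hk : k ∈ Finset.Icc (-(N : ℤ)) N) :
    coef (fun x => (residual U t x : ℂ)) k = V' k - kawaharaRhs (V t) k := by
  simp only [ofReal_residual ht hU hV]
  rw [coef_add (F := fun x => trigPoly N (V t) x * trigPoly N (fun k => Complex.I * k * V t k) x)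
      (integrableOn_of_continuous ((continuous_trigPoly _ _).mul (continuous_trigPoly _ _)))
      (integrableOn_of_continuous (continuous_trigPoly _ _)),
    coef_trigPoly_mul hs (integrableOn_of_continuous (continuous_trigPoly _ _)), coef_trigPoly,
    head_of_mem _ hk]
  have : coef (trigPoly N fun k => Complex.I * k * V t k) = fun k => Complex.I * k * V t k := by
    funext k
    exact coef_trigPoly_of_support (fun k hk => by rw [hs k hk, mul_zero]) k
  rw [show coef (fun x => trigPoly N (fun k => Complex.I * k * V t k) x) = _ from this,
    conv_deriv hs]
  unfold kawaharaRhs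
  ring

theorem continuous_residual (ht : 0 ≤ t)
    (hU : ∀ s, 0 ≤ s → ∀ x, (U s x : ℂ) = trigPoly N (V s) x)
    (hV : ∀ k ∈ Finset.Icc (-(N : ℤ)) N,
      HasDerivWithinAt (fun s => V s k) (V' k) (Set.Ici 0) t) :
    Continuous fun x => (residual U t x : ℂ) := by
  simp only [ofReal_residual ht hU hV]
  exact ((continuous_trigPoly _ _).mul (continuous_trigPoly _ _)).add (continuous_trigPoly _ _)

end Residual

/-! ### Equivalence of the scheme with the truncated system -/

/-- The discrete Fourier inversion formula on `2N+1` equispaced nodes. -/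
theorem eq_discrete_sum {N : ℕ} (c : ℤ → ℂ) {k : ℤ} (hk : k ∈ Finset.Icc (-(N : ℤ)) N) :
    c k = (2 * N + 1 : ℂ)⁻¹ * ∑ j ∈ Finset.range (2 * N + 1),
      Complex.exp (-(Complex.I * k * (2 * Real.pi * j / (2 * N + 1) : ℝ))) *
        trigPoly N c (2 * Real.pi * j / (2 * N + 1)) := by
  have hM : (2 * N + 1 : ℂ) ≠ 0 := by exact_mod_cast (by omega : 2 * N + 1 ≠ 0)
  have hpi : (Real.pi : ℂ) ≠ 0 := by exact_mod_cast Real.pi_ne_zero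
  have hgeo : ∀ l ∈ Finset.Icc (-(N : ℤ)) N, ∑ j ∈ Finset.range (2 * N + 1),
      Complex.exp (Complex.I * (l - k) * (2 * Real.pi / (2 * N + 1))) ^ j =
        if l = k then (2 * N + 1 : ℂ) else 0 := fun l hl => by
    split_ifs with h
    · subst h
      simp
    · set ζ := Complex.exp (Complex.I * (l - k) * (2 * Real.pi / (2 * N + 1))) with hζ
      have h1 : ζ ^ (2 * N + 1) = 1 := by
        rw [hζ, ← Complex.exp_nat_mul, Complex.exp_eq_one_iff]
        refine ⟨l - k, ?_⟩
        push_cast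
        field_simp
      -- Two frequencies in the window differ by at most 2N in size, so they agree modulo 2N+1 only
      -- if they are equal.
      have h2 : ζ ≠ 1 := by
        rw [hζ, Ne, Complex.exp_eq_one_iff]
        rintro ⟨n, hn⟩
        have h3 : ((l - k : ℤ) : ℂ) = ((n * (2 * N + 1) : ℤ) : ℂ) := by
          push_cast
          field_simp at hn
          linear_combination hn
        have h4 : l - k = n * (2 * N + 1) := by exact_mod_cast h3
        have h5 := Finset.mem_Icc.mp hl
        have h6 := Finset.mem_Icc.mp hk
        have hn0 : n ≠ 0 := by rintro rfl; omega
        rcases lt_or_gt_of_ne hn0 with hn0 | hn0 <;> nlinarith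
      have h3 := mul_neg_geom_sum ζ (2 * N + 1)
      rw [h1, sub_self, mul_eq_zero, or_iff_right (sub_ne_zero.mpr h2.symm)] at h3
      exact h3
  have hsum : ∑ j ∈ Finset.range (2 * N + 1),
      Complex.exp (-(Complex.I * k * (2 * Real.pi * j / (2 * N + 1) : ℝ))) *
        trigPoly N c (2 * Real.pi * j / (2 * N + 1)) =
      ∑ l ∈ Finset.Icc (-(N : ℤ)) N, c l * ∑ j ∈ Finset.range (2 * N + 1),
        Complex.exp (Complex.I * (l - k) * (2 * Real.pi / (2 * N + 1))) ^ j := by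
    simp only [trigPoly, Finset.mul_sum]
    rw [Finset.sum_comm]
    refine Finset.sum_congr rfl fun l _ => Finset.sum_congr rfl fun j _ => ?_
    rw [mul_left_comm, ← Complex.exp_add, ← Complex.exp_nat_mul]
    congr 2
    push_cast
    ring
  rw [hsum, Finset.sum_congr rfl fun l hl => by rw [hgeo l hl]]
  simp only [mul_ite, mul_zero, Finset.sum_ite_eq', if_pos hk]
  field_simp

theorem periodic_of_mem {N : ℕ} {g : ℝ → ℝ} (hg : (fun x => (g x : ℂ)) ∈ trigSpace N) :
    Function.Periodic g (2 * Real.pi) := by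
  obtain ⟨c, hc⟩ := exists_eq_trigPoly hg
  intro x
  apply Complex.ofReal_injective
  have h : ∀ y, (g y : ℂ) = trigPoly N c y := fun y => congrFun hc y
  rw [h, h]
  unfold trigPoly
  refine Finset.sum_congr rfl fun k _ => ?_
  congr 1
  rw [Complex.exp_eq_exp_iff_exists_int]
  exact ⟨k, by push_cast; ring⟩

theorem memL2_of_mem {N : ℕ} {g : ℝ → ℝ} (hg : (fun x => (g x : ℂ)) ∈ trigSpace N) :
    MemL2 g := by
  have hc : Continuous g := by
    obtain ⟨c, hc⟩ := exists_eq_trigPoly hg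
    have h := Complex.continuous_re.comp (hc ▸ continuous_trigPoly N c)
    exact h
  refine ⟨periodic_of_mem hg, ?_⟩
  obtain ⟨C, hC⟩ := isCompact_Icc.exists_bound_of_continuousOn
    (hc.continuousOn (s := Set.Icc (-Real.pi) Real.pi))
  refine MeasureTheory.MemLp.of_bound hc.aestronglyMeasurable C ?_
  rw [MeasureTheory.ae_restrict_iff' measurableSet_Ioc]
  exact Filter.Eventually.of_forall fun x hx => hC x (Set.Ioc_subset_Icc_self hx)

theorem IsProjection.fourierCoef_eq {N : ℕ} {f g : ℝ → ℝ} (h : IsProjection N f g)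
    (hf : MemL2 f) {k : ℤ} (hk : k ∈ Finset.Icc (-(N : ℤ)) N) :
    fourierCoef g k = fourierCoef f k := by
  have h1 := h.2 _ (exp_mem_trigSpace hk)
  have h2 : (2 * Real.pi : ℂ) ≠ 0 := by simp [Real.pi_ne_zero]
  rw [l2Inner_exp, mul_eq_zero, or_iff_right h2] at h1
  have h3 := fourierCoef_sub hf (memL2_of_mem h.1) k
  rw [show fourierCoef (fun x => f x - g x) k = 0 from h1] at h3
  exact (sub_eq_zero.mp h3.symm).symm

theorem IsGalerkinSolution.eq_trigPoly {N : ℕ} {f : ℝ → ℝ} {U : ℝ → ℝ → ℝ}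
    (hU : IsGalerkinSolution N f U) {t : ℝ} (ht : 0 ≤ t) (x : ℝ) :
    (U t x : ℂ) = trigPoly N (fourierCoef (U t)) x :=
  congrFun (eq_trigPoly_coef (hU.mem t ht)) x

theorem IsGalerkinSolution.fourierCoef_eq_zero {N : ℕ} {f : ℝ → ℝ} {U : ℝ → ℝ → ℝ}
    (hU : IsGalerkinSolution N f U) {t : ℝ} (ht : 0 ≤ t) (k : ℤ) (hk : (N : ℤ) < |k|) :
    fourierCoef (U t) k = 0 := coef_eq_zero_of_mem (hU.mem t ht) hk

/-- The Fourier coefficients of a Galerkin solution solve the truncated system. -/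
theorem IsGalerkinSolution.hasDerivWithinAt {N : ℕ} {f : ℝ → ℝ} {U : ℝ → ℝ → ℝ}
    (hU : IsGalerkinSolution N f U) {t : ℝ} (ht : 0 ≤ t) {k : ℤ}
    (hk : k ∈ Finset.Icc (-(N : ℤ)) N) :
    HasDerivWithinAt (fun s => fourierCoef (U s) k) (kawaharaRhs (fourierCoef (U t)) k)
      (Set.Ici 0) t := by
  have hd : ∀ k ∈ Finset.Icc (-(N : ℤ)) N,
      DifferentiableWithinAt ℝ (fun s => fourierCoef (U s) k) (Set.Ici 0) t := fun k hk => by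
    -- Differentiability in time is given only pointwise in x. Discrete inversion writes the
    -- coefficient as a finite combination of point values, so it inherits differentiability.
    have h1 : DifferentiableWithinAt ℝ (fun s => (2 * N + 1 : ℂ)⁻¹ *
        ∑ j ∈ Finset.range (2 * N + 1),
          Complex.exp (-(Complex.I * k * (2 * Real.pi * j / (2 * N + 1) : ℝ))) *
          (U s (2 * Real.pi * j / (2 * N + 1)) : ℂ)) (Set.Ici 0) t := by
      refine DifferentiableWithinAt.const_mul (DifferentiableWithinAt.fun_sum fun j _ => ?_) _
      exact ((hU.differentiable t ht _).hasDerivWithinAt.ofReal_comp.const_mul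
        _).differentiableWithinAt
    refine h1.congr (fun s hs => ?_) ?_
    · rw [eq_discrete_sum (fourierCoef (U s)) hk]
      simp only [hU.eq_trigPoly hs]
    · rw [eq_discrete_sum (fourierCoef (U t)) hk]
      simp only [hU.eq_trigPoly ht]
  have h1 := coef_residual ht (fun s hs x => hU.eq_trigPoly hs x)
    (hU.fourierCoef_eq_zero ht) (fun k hk => (hd k hk).hasDerivWithinAt) hk
  have h2 := hU.equation t ht _ (exp_mem_trigSpace hk)
  rw [l2Inner_exp, mul_eq_zero, or_iff_right (by simp [Real.pi_ne_zero]), h1, sub_eq_zero] at h2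
  rw [← h2]
  exact (hd k hk).hasDerivWithinAt

theorem ofReal_re_trigPoly {N : ℕ} {c : ℤ → ℂ} (hc : ∀ k, c (-k) = conj (c k)) (x : ℝ) :
    ((trigPoly N c x).re : ℂ) = trigPoly N c x := by
  rw [← Complex.conj_eq_iff_re]
  unfold trigPoly
  rw [map_sum, ← sum_Icc_neg]
  refine Finset.sum_congr rfl fun k _ => ?_
  rw [hc, map_mul, Complex.conj_conj, ← Complex.exp_conj]
  simp

/-- A solution of the truncated system gives a Galerkin solution. -/
theorem isGalerkinSolution_of_hasDerivWithinAt {N : ℕ} {f : ℝ → ℝ} (hf : MemL2 f)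
    {V : ℝ → ℤ → ℂ} (hc : ∀ t, 0 ≤ t → ∀ k, V t (-k) = conj (V t k))
    (hs : ∀ t, 0 ≤ t → ∀ k : ℤ, (N : ℤ) < |k| → V t k = 0)
    (hV : ∀ t, 0 ≤ t → ∀ k ∈ Finset.Icc (-(N : ℤ)) N,
      HasDerivWithinAt (fun s => V s k) (kawaharaRhs (V t) k) (Set.Ici 0) t)
    (h0 : ∀ k ∈ Finset.Icc (-(N : ℤ)) N, V 0 k = fourierCoef f k) :
    IsGalerkinSolution N f fun t x => (trigPoly N (V t) x).re := by
  have hU : ∀ s, 0 ≤ s → ∀ x, (((trigPoly N (V s) x).re : ℝ) : ℂ) = trigPoly N (V s) x :=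
    fun s hs x => ofReal_re_trigPoly (hc s hs) x
  have hmem : ∀ t, 0 ≤ t → (fun x => (((trigPoly N (V t) x).re : ℝ) : ℂ)) ∈ trigSpace N :=
    fun t ht => by
      rw [funext (hU t ht)]
      exact trigPoly_mem N (V t)
  refine ⟨hmem, fun t ht x => ?_, fun t ht φ hφ => ?_, hmem 0 le_rfl, fun φ hφ => ?_⟩
  · have hd : HasDerivWithinAt (fun s => trigPoly N (V s) x)
        (trigPoly N (kawaharaRhs (V t)) x) (Set.Ici 0) t := by
      unfold trigPoly
      exact HasDerivWithinAt.fun_sum fun k hk => (hV t ht k hk).mul_const _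
    exact (Complex.reCLM.hasFDerivAt.comp_hasDerivWithinAt t hd).differentiableWithinAt
  · refine l2Inner_eq_zero_of_coef (integrableOn_of_continuous
      (continuous_residual ht hU (hV t ht))) (fun k hk => ?_) hφ
    rw [coef_residual ht hU (hs t ht) (hV t ht) hk, sub_self]
  · have hg := memL2_of_mem (hmem 0 le_rfl)
    refine l2Inner_eq_zero_of_coef (integrableOn_ofReal (hf.sub hg).integrableOn)
      (fun k hk => ?_) hφ
    refine (fourierCoef_sub hf hg k).trans ?_
    have h1 : fourierCoef (fun x => (trigPoly N (V 0) x).re) k = V 0 k := by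
      have h2 : fourierCoef (fun x => (trigPoly N (V 0) x).re) k =
          coef (fun x => (((trigPoly N (V 0) x).re : ℝ) : ℂ)) k := rfl
      rw [h2, funext (hU 0 le_rfl)]
      exact coef_trigPoly_of_support (hs 0 le_rfl) k
    rw [h1, h0 k hk, sub_self]

/-! ### Global solvability of ordinary differential equations -/

/-- Global existence for a bounded, globally Lipschitz vector field. -/
theorem exists_forall_hasDerivWithinAt_of_lipschitz {E : Type*} [NormedAddCommGroup E]
    [NormedSpace ℝ E] [CompleteSpace E] {F : E → E} {K L : NNReal} (hF : LipschitzWith K F)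
    (hL : ∀ y, ‖F y‖ ≤ L) (x₀ : E) :
    ∃ x : ℝ → E, x 0 = x₀ ∧ ∀ t, 0 ≤ t → HasDerivWithinAt x (F (x t)) (Set.Ici 0) t := by
  have hex : ∀ n : ℕ, ∃ α : ℝ → E, α 0 = x₀ ∧ ∀ t ∈ Set.Icc (0 : ℝ) (n + 1),
      HasDerivWithinAt α (F (α t)) (Set.Icc 0 (n + 1)) t := fun n => by
    -- A field bounded by L cannot leave the ball of radius L(n+1) within time n+1, so
    -- Picard–Lindelöf applies on the whole interval.
    have hPL : IsPicardLindelof (fun _ => F) (tmin := 0) (tmax := n + 1)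
        ⟨0, le_rfl, by positivity⟩ x₀ (L * (n + 1)) 0 L K :=
      ⟨fun _ _ => hF.lipschitzOnWith, fun _ _ => continuousOn_const, fun _ _ y _ => hL y, by
        simp only [sub_zero, sub_self]
        rw [max_eq_left (by positivity)]
        push_cast
        simp⟩
    exact hPL.exists_eq_forall_mem_Icc_hasDerivWithinAt₀
  choose α hα0 hα using hex
  have huniq : ∀ m n : ℕ, m ≤ n → ∀ s ∈ Set.Icc (0 : ℝ) (m + 1), α m s = α n s := by
    intro m n hmn
    have hmn' : (m : ℝ) ≤ n := by exact_mod_cast hmn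
    have hsub : Set.Icc (0 : ℝ) (m + 1) ⊆ Set.Icc (0 : ℝ) (n + 1) :=
      Set.Icc_subset_Icc_right (by linarith)
    have hIci : ∀ p : ℕ, ∀ t ∈ Set.Ico (0 : ℝ) (p + 1),
        HasDerivWithinAt (α p) (F (α p t)) (Set.Ici t) t := fun p t ht =>
      (hα p t (Set.Ico_subset_Icc_self ht)).mono_of_mem_nhdsWithin (Icc_mem_nhdsGE_of_mem ht)
    exact ODE_solution_unique_of_mem_Icc_right (v := fun _ => F) (s := fun _ => Set.univ)
      (fun _ _ => hF.lipschitzOnWith)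
      (fun t ht => (hα m t ht).continuousWithinAt)
      (fun t ht => hIci m t ht) (fun _ _ => Set.mem_univ _)
      (fun t ht => ((hα n t (hsub ht)).continuousWithinAt).mono hsub)
      (fun t ht => hIci n t ⟨ht.1, by linarith [ht.2]⟩) (fun _ _ => Set.mem_univ _)
      ((hα0 m).trans (hα0 n).symm)
  -- At time t the solution on [0, ⌊t⌋+1] is used, so t lies strictly before the right endpoint and
  -- the nearby values agree by uniqueness.
  refine ⟨fun t => α ⌊t⌋₊ t, by simp [hα0], fun t ht => ?_⟩
  set n := ⌊t⌋₊
  have htn : t < n + 1 := Nat.lt_floor_add_one t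
  have hd : HasDerivWithinAt (α n) (F (α n t)) (Set.Ici 0) t :=
    (hα n t ⟨ht, htn.le⟩).mono_of_mem_nhdsWithin
      (Filter.mem_of_superset (Filter.inter_mem self_mem_nhdsWithin
        (mem_nhdsWithin_of_mem_nhds (Iio_mem_nhds htn))) fun s hs => ⟨hs.1, le_of_lt hs.2⟩)
  refine hd.congr_of_eventuallyEq_of_mem ?_ ht
  filter_upwards [self_mem_nhdsWithin, mem_nhdsWithin_of_mem_nhds (Iio_mem_nhds htn)] with s hs hs'
  refine huniq _ _ ?_ s ⟨hs, (Nat.lt_floor_add_one s).le⟩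
  rw [← Nat.lt_add_one_iff, Nat.floor_lt hs]
  exact_mod_cast hs'

/-- Global existence and uniqueness for a smooth vector field that is orthogonal to the position
vector. -/
theorem exists_forall_hasDerivWithinAt_of_inner_eq_zero {E : Type*} [NormedAddCommGroup E]
    [InnerProductSpace ℝ E] [FiniteDimensional ℝ E] {G : E → E} (hG : ContDiff ℝ 1 G)
    (horth : ∀ y, inner ℝ y (G y) = 0) (x₀ : E) :
    ∃ x : ℝ → E, (x 0 = x₀ ∧ ∀ t, 0 ≤ t → HasDerivWithinAt x (G (x t)) (Set.Ici 0) t) ∧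
      ∀ y : ℝ → E, y 0 = x₀ → (∀ t, 0 ≤ t → HasDerivWithinAt y (G (y t)) (Set.Ici 0) t) →
        ∀ t, 0 ≤ t → y t = x t := by
  have : CompleteSpace E := FiniteDimensional.complete ℝ E
  -- The cutoff makes the field bounded and Lipschitz. It equals 1 on a ball containing the sphere
  -- of radius ‖x₀‖, to which orthogonality confines the solutions.
  let χ : ContDiffBump (0 : E) := ⟨‖x₀‖ + 1, ‖x₀‖ + 2, by positivity, by linarith⟩
  set F : E → E := fun y => χ y • G y with hFdef
  have hFc : ContDiff ℝ 1 F := χ.contDiff.smul hG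
  have hFs : HasCompactSupport F := χ.hasCompactSupport.smul_right
  obtain ⟨K, hK⟩ := hFc.lipschitzWith_of_hasCompactSupport hFs one_ne_zero
  obtain ⟨L, hL⟩ := hFs.exists_bound_of_continuous hFc.continuous
  have hFG : ∀ y, ‖y‖ = ‖x₀‖ → F y = G y := fun y hy => by
    simp only [hFdef]
    have hy' : y ∈ Metric.closedBall (0 : E) χ.rIn := by
      rw [mem_closedBall_zero_iff, hy]
      change _ ≤ ‖x₀‖ + 1
      linarith
    rw [χ.one_of_mem_closedBall hy', one_smul]
  -- The scalar c covers the cut-off field (c = χ) and the original one (c = 1) at once: a multiple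
  -- of a field orthogonal to y still preserves ‖y‖.
  have hnorm : ∀ (c : E → ℝ) (y : ℝ → E), y 0 = x₀ →
      (∀ t, 0 ≤ t → HasDerivWithinAt y (c (y t) • G (y t)) (Set.Ici 0) t) →
      ∀ t, 0 ≤ t → ‖y t‖ = ‖x₀‖ := fun c y hy0 hy t ht => by
    have h1 : ∀ s, 0 ≤ s → HasDerivWithinAt (fun s => ‖y s‖ ^ 2) 0 (Set.Ici 0) s :=
      fun s hs => (hy s hs).norm_sq.congr_deriv (by rw [inner_smul_right, horth]; simp)
    have h2 := eq_of_hasDerivWithinAt_zero h1 ht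
    simp only [hy0] at h2
    exact (sq_eq_sq₀ (norm_nonneg _) (norm_nonneg _)).mp h2
  obtain ⟨x, hx0, hx⟩ := exists_forall_hasDerivWithinAt_of_lipschitz hK (L := L.toNNReal)
    (fun y => (hL y).trans (Real.le_coe_toNNReal L)) x₀
  have hxn := hnorm χ x hx0 hx
  refine ⟨x, ⟨hx0, fun t ht => hFG _ (hxn t ht) ▸ hx t ht⟩, fun y hy0 hy t ht => ?_⟩
  have hyn := hnorm (fun _ => 1) y hy0 (by simpa only [one_smul] using hy)
  exact ODE_solution_unique_of_mem_Icc_right (a := 0) (b := t) (v := fun _ => F)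
    (s := fun _ => Set.univ) (fun _ _ => hK.lipschitzOnWith)
    (fun s hs => ((hy s hs.1).continuousWithinAt).mono Set.Icc_subset_Ici_self)
    (fun s hs => by
      rw [hFG _ (hyn s hs.1)]
      exact (hy s hs.1).mono (Set.Ici_subset_Ici.mpr hs.1)) (fun _ _ => Set.mem_univ _)
    (fun s hs => ((hx s hs.1).continuousWithinAt).mono Set.Icc_subset_Ici_self)
    (fun s hs => (hx s hs.1).mono (Set.Ici_subset_Ici.mpr hs.1)) (fun _ _ => Set.mem_univ _)
    (hy0.trans hx0.symm) ⟨ht, le_rfl⟩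

/-! ### The truncated system on its phase space -/

/-- The phase space of the truncated system. -/
abbrev PhaseSpace (N : ℕ) : Type := EuclideanSpace ℂ (Finset.Icc (-(N : ℤ)) N)

/-- Restriction of a sequence to frequencies up to `N`. -/
def restrictSeq (N : ℕ) (c : ℤ → ℂ) : PhaseSpace N := WithLp.toLp 2 fun k => c k

/-- Extension by zero. -/
def extendSeq {N : ℕ} (y : PhaseSpace N) (k : ℤ) : ℂ :=
  if h : k ∈ Finset.Icc (-(N : ℤ)) N then y ⟨k, h⟩ else 0

/-- Extension by zero, symmetrized so as to be the coefficients of a real function. -/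
def symmSeq {N : ℕ} (y : PhaseSpace N) (k : ℤ) : ℂ :=
  (extendSeq y k + conj (extendSeq y (-k))) / 2

/-- The vector field of the truncated system. -/
def galerkinField (N : ℕ) (y : PhaseSpace N) : PhaseSpace N :=
  restrictSeq N fun k => Complex.I * omega k * extendSeq y k -
    Complex.I * k / 2 * conv (symmSeq y) (symmSeq y) k

theorem extendSeq_of_lt {N : ℕ} (y : PhaseSpace N) {k : ℤ} (hk : (N : ℤ) < |k|) :
    extendSeq y k = 0 := dif_neg (not_mem_Icc_iff.mpr hk)

theorem extendSeq_of_mem {N : ℕ} (y : PhaseSpace N) {k : ℤ} (hk : k ∈ Finset.Icc (-(N : ℤ)) N) :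
    extendSeq y k = y ⟨k, hk⟩ := dif_pos hk

theorem extendSeq_restrictSeq {N : ℕ} {c : ℤ → ℂ} (hc : ∀ k : ℤ, (N : ℤ) < |k| → c k = 0) :
    extendSeq (restrictSeq N c) = c := by
  funext k
  by_cases hk : k ∈ Finset.Icc (-(N : ℤ)) N
  · rw [extendSeq_of_mem _ hk]; rfl
  · rw [extendSeq_of_lt _ (not_mem_Icc_iff.mp hk), hc k (not_mem_Icc_iff.mp hk)]

theorem symmSeq_of_lt {N : ℕ} (y : PhaseSpace N) (k : ℤ) (hk : (N : ℤ) < |k|) :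
    symmSeq y k = 0 := by
  rw [symmSeq, extendSeq_of_lt y hk, extendSeq_of_lt y (by rwa [abs_neg])]
  simp

theorem symmSeq_neg {N : ℕ} (y : PhaseSpace N) (k : ℤ) : symmSeq y (-k) = conj (symmSeq y k) := by
  unfold symmSeq
  rw [neg_neg, map_div₀, map_add, Complex.conj_conj, map_ofNat, add_comm]

theorem symmSeq_eq {N : ℕ} {y : PhaseSpace N}
    (h : ∀ k, extendSeq y (-k) = conj (extendSeq y k)) : symmSeq y = extendSeq y := by
  funext k
  rw [symmSeq, h, Complex.conj_conj]
  ring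

theorem contDiff_extendSeq (N : ℕ) (k : ℤ) :
    ContDiff ℝ 1 fun y : PhaseSpace N => extendSeq y k := by
  unfold extendSeq
  split_ifs with h
  · exact (contDiff_piLp (𝕜 := ℝ) (f := fun y : PhaseSpace N => y) 2).mp contDiff_id ⟨k, h⟩
  · exact contDiff_const

theorem contDiff_symmSeq (N : ℕ) (k : ℤ) : ContDiff ℝ 1 fun y : PhaseSpace N => symmSeq y k := by
  unfold symmSeq
  exact ((contDiff_extendSeq N k).add
    (Complex.conjCLE.contDiff.comp (contDiff_extendSeq N (-k)))).div_const 2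

theorem contDiff_galerkinField (N : ℕ) : ContDiff ℝ 1 (galerkinField N) := by
  refine (contDiff_piLp 2).mpr fun k => ?_
  have hc : ∀ k : ℤ, (fun y : PhaseSpace N => conv (symmSeq y) (symmSeq y) k) = fun y =>
      ∑ a ∈ Finset.Icc (-(N : ℤ)) N, symmSeq y a * symmSeq y (k - a) := fun k => by
    funext y
    exact tsum_eq_sum fun a ha => by rw [symmSeq_of_lt y a (not_mem_Icc_iff.mp ha), zero_mul]
  have h : ContDiff ℝ 1 fun y : PhaseSpace N => conv (symmSeq y) (symmSeq y) k := by
    rw [hc]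
    exact ContDiff.sum fun a _ => (contDiff_symmSeq N a).mul (contDiff_symmSeq N _)
  exact (contDiff_const.mul (contDiff_extendSeq N k)).sub (contDiff_const.mul h)

/-- The nonlinearity is built from the symmetrized sequence, so it is the transform of a real
function and only the symmetric part of y pairs with it. The pairing thus reduces to the vanishing
cubic sum, even for y not coming from a real function. -/
theorem inner_galerkinField (N : ℕ) (y : PhaseSpace N) : inner ℝ y (galerkinField N y) = 0 := by
  have h1 : inner ℝ y (galerkinField N y) = ∑ k ∈ Finset.Icc (-(N : ℤ)) N,
      (conj (extendSeq y k) * (Complex.I * omega k * extendSeq y k -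
        Complex.I * k / 2 * conv (symmSeq y) (symmSeq y) k)).re := by
    rw [PiLp.inner_apply]
    refine Eq.trans ?_ (Finset.sum_coe_sort (Finset.Icc (-(N : ℤ)) N) _)
    refine Finset.sum_congr rfl fun k _ => ?_
    rw [Complex.inner, extendSeq_of_mem y k.2, mul_comm]
    simp only [galerkinField, restrictSeq, extendSeq_of_mem y k.2]
  set D := conv (symmSeq y) (symmSeq y) with hD
  have hDn : ∀ k, D (-k) = conj (D k) := conv_neg_index (symmSeq_neg y) (symmSeq_neg y)
  have h2 : ∀ k : ℤ, (conj (extendSeq y k) * (Complex.I * omega k * extendSeq y k -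
        Complex.I * k / 2 * D k)).re =
      (-(Complex.I * k) * D k * conj (extendSeq y k)).re / 2 := fun k => by
    have h3 : conj (extendSeq y k) * (Complex.I * omega k * extendSeq y k -
        Complex.I * k / 2 * D k) = ((omega k * ‖extendSeq y k‖ ^ 2 : ℝ) : ℂ) * Complex.I +
        ((1 / 2 : ℝ) : ℂ) * (-(Complex.I * k) * D k * conj (extendSeq y k)) := by
      have h4 : conj (extendSeq y k) * extendSeq y k = ((‖extendSeq y k‖ ^ 2 : ℝ) : ℂ) := by
        rw [mul_comm, Complex.mul_conj, Complex.normSq_eq_norm_sq]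
      rw [Complex.ofReal_mul, ← h4]
      push_cast
      ring
    rw [h3, Complex.add_re, Complex.re_ofReal_mul, Complex.re_ofReal_mul, Complex.I_re]
    ring
  -- The substitution k ↦ −k with conjugation preserves the real part, so y and its reflected
  -- conjugate pair equally with the nonlinearity.
  have h5 : ∑ k ∈ Finset.Icc (-(N : ℤ)) N, (-(Complex.I * k) * D k * conj (extendSeq y k)).re =
      ∑ k ∈ Finset.Icc (-(N : ℤ)) N, (-(Complex.I * k) * D k * extendSeq y (-k)).re := by
    rw [← sum_Icc_neg]
    refine Finset.sum_congr rfl fun k _ => ?_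
    rw [hDn, ← Complex.conj_re]
    congr 1
    simp
  have h6 := sum_conv_self_eq_zero (symmSeq_of_lt y) (symmSeq_neg y)
  have h7 := congrArg Complex.re h6
  rw [Complex.re_sum, Complex.zero_re] at h7
  have h8 : ∑ k ∈ Finset.Icc (-(N : ℤ)) N, (-(Complex.I * k) * D k * conj (symmSeq y k)).re =
      (∑ k ∈ Finset.Icc (-(N : ℤ)) N, (-(Complex.I * k) * D k * conj (extendSeq y k)).re +
      ∑ k ∈ Finset.Icc (-(N : ℤ)) N, (-(Complex.I * k) * D k * extendSeq y (-k)).re) / 2 := by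
    rw [← Finset.sum_add_distrib, Finset.sum_div]
    refine Finset.sum_congr rfl fun k _ => ?_
    have : -(Complex.I * k) * D k * conj (symmSeq y k) = ((1 / 2 : ℝ) : ℂ) *
        (-(Complex.I * k) * D k * conj (extendSeq y k) +
          -(Complex.I * k) * D k * extendSeq y (-k)) := by
      unfold symmSeq
      rw [map_div₀, map_add, Complex.conj_conj, map_ofNat]
      push_cast
      ring
    rw [this, Complex.re_ofReal_mul, Complex.add_re]
    ring
  rw [h1, Finset.sum_congr rfl fun k _ => h2 k, ← Finset.sum_div]
  rw [h8, ← h5] at h7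
  linarith

theorem hasDerivWithinAt_restrictSeq {N : ℕ} {c : ℝ → ℤ → ℂ} {y : PhaseSpace N} {s : Set ℝ} {t : ℝ}
    (h : ∀ k ∈ Finset.Icc (-(N : ℤ)) N, HasDerivWithinAt (fun τ => c τ k) (extendSeq y k) s t) :
    HasDerivWithinAt (fun τ => restrictSeq N (c τ)) y s t := by
  rw [hasDerivWithinAt_iff_hasFDerivWithinAt, hasFDerivWithinAt_piLp]
  intro k
  have := (h k k.2).hasFDerivWithinAt
  rw [extendSeq_of_mem y k.2] at this
  exact this.congr_fderiv (by ext; simp)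

theorem hasDerivWithinAt_extendSeq {N : ℕ} {c : ℝ → PhaseSpace N} {y : PhaseSpace N} {s : Set ℝ}
    {t : ℝ} (h : HasDerivWithinAt c y s t) (k : ℤ) :
    HasDerivWithinAt (fun τ => extendSeq (c τ) k) (extendSeq y k) s t := by
  by_cases hk : k ∈ Finset.Icc (-(N : ℤ)) N
  · simp only [extendSeq_of_mem _ hk]
    have := (hasFDerivWithinAt_piLp 2).mp h.hasFDerivWithinAt ⟨k, hk⟩
    have := this.hasDerivWithinAt
    simpa using this
  · simp only [extendSeq_of_lt _ (not_mem_Icc_iff.mp hk)]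
    exact hasDerivWithinAt_const _ _ _

theorem extendSeq_galerkinField_of_symm {N : ℕ} {y : PhaseSpace N}
    (h : ∀ k, extendSeq y (-k) = conj (extendSeq y k)) {k : ℤ}
    (hk : k ∈ Finset.Icc (-(N : ℤ)) N) :
    extendSeq (galerkinField N y) k = kawaharaRhs (extendSeq y) k := by
  rw [extendSeq_of_mem _ hk, ← symmSeq_eq h]
  simp only [galerkinField, restrictSeq, kawaharaRhs, symmSeq_eq h]

/-- The nonlinearity respects conjugation symmetry, so the defect from reality evolves by the linear
flow alone and keeps its modulus. -/
theorem extendSeq_galerkinField_sub_conj {N : ℕ} (y : PhaseSpace N) (k : ℤ) :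
    extendSeq (galerkinField N y) k - conj (extendSeq (galerkinField N y) (-k)) =
      Complex.I * omega k * (extendSeq y k - conj (extendSeq y (-k))) := by
  by_cases hk : k ∈ Finset.Icc (-(N : ℤ)) N
  · rw [extendSeq_of_mem _ hk, extendSeq_of_mem _ (neg_mem_Icc_iff.mpr hk)]
    simp only [galerkinField, restrictSeq]
    rw [conv_neg_index (symmSeq_neg y) (symmSeq_neg y)]
    simp only [map_sub, map_mul, map_div₀, Complex.conj_I, Complex.conj_ofReal, map_intCast,
      map_ofNat, Complex.conj_conj, omega]
    push_cast
    ring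
  · have h1 := not_mem_Icc_iff.mp hk
    rw [extendSeq_of_lt _ h1, extendSeq_of_lt _ h1, extendSeq_of_lt _ (by rwa [abs_neg]),
      extendSeq_of_lt _ (by rwa [abs_neg])]
    simp

/-- Solutions of the truncated system starting from a real function stay real. -/
theorem extendSeq_conj_symm {N : ℕ} {x : ℝ → PhaseSpace N}
    (hx : ∀ t, 0 ≤ t → HasDerivWithinAt x (galerkinField N (x t)) (Set.Ici 0) t)
    (h0 : ∀ k, extendSeq (x 0) (-k) = conj (extendSeq (x 0) k)) {t : ℝ} (ht : 0 ≤ t) (k : ℤ) :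
    extendSeq (x t) (-k) = conj (extendSeq (x t) k) := by
  set d : ℝ → ℂ := fun t => extendSeq (x t) k - conj (extendSeq (x t) (-k)) with hd
  have h1 : ∀ t, 0 ≤ t → HasDerivWithinAt d (Complex.I * omega k * d t) (Set.Ici 0) t :=
    fun t ht => by
      have h := (hasDerivWithinAt_extendSeq (hx t ht) k).sub
        (hasDerivWithinAt_extendSeq (hx t ht) (-k)).star
      exact h.congr_deriv (extendSeq_galerkinField_sub_conj (x t) k)
  have h2 : ∀ t, 0 ≤ t → HasDerivWithinAt (fun t => ‖d t‖ ^ 2) 0 (Set.Ici 0) t := fun t ht => by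
    refine (h1 t ht).norm_sq.congr_deriv ?_
    rw [Complex.inner, mul_assoc, mul_assoc, Complex.mul_conj]
    simp
  have h3 := eq_of_hasDerivWithinAt_zero h2 ht
  have h4 : d 0 = 0 := by
    simp only [hd]
    rw [h0, Complex.conj_conj, sub_self]
  simp only [h4, norm_zero, ne_eq, OfNat.ofNat_ne_zero, not_false_eq_true, zero_pow,
    sq_eq_zero_iff, norm_eq_zero] at h3
  have h5 : extendSeq (x t) k = conj (extendSeq (x t) (-k)) := sub_eq_zero.mp h3
  rw [h5, Complex.conj_conj]

/-- The Galerkin scheme has a unique global solution. -/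
theorem exists_unique_isGalerkinSolution (N : ℕ) {f : ℝ → ℝ} (hf : MemL2 f) :
    ∃ U : ℝ → ℝ → ℝ, IsGalerkinSolution N f U ∧
      ∀ U' : ℝ → ℝ → ℝ, IsGalerkinSolution N f U' → ∀ t, 0 ≤ t → ∀ x, U' t x = U t x := by
  obtain ⟨x, ⟨hx0, hx⟩, huniq⟩ := exists_forall_hasDerivWithinAt_of_inner_eq_zero
    (contDiff_galerkinField N) (inner_galerkinField N) (restrictSeq N (head N (fourierCoef f)))
  have hh : ∀ k : ℤ, (N : ℤ) < |k| → head N (fourierCoef f) k = 0 := fun k hk => if_pos hk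
  have h0 : extendSeq (x 0) = head N (fourierCoef f) := by rw [hx0, extendSeq_restrictSeq hh]
  have hsymm : ∀ t, 0 ≤ t → ∀ k, extendSeq (x t) (-k) = conj (extendSeq (x t) k) :=
    fun t ht k => extendSeq_conj_symm hx (fun k => by
      rw [h0, head, head, abs_neg, fourierCoef_neg]
      split_ifs <;> simp) ht k
  refine ⟨fun t y => (trigPoly N (extendSeq (x t)) y).re,
    isGalerkinSolution_of_hasDerivWithinAt hf hsymm (fun t _ k hk => extendSeq_of_lt _ hk)
      (fun t ht k hk => ?_) (fun k hk => by rw [h0, head_of_mem _ hk]), fun U' hU' t ht y => ?_⟩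
  · rw [← extendSeq_galerkinField_of_symm (hsymm t ht) hk]
    exact hasDerivWithinAt_extendSeq (hx t ht) k
  · have hext : ∀ t, 0 ≤ t → extendSeq (restrictSeq N (fourierCoef (U' t))) =
        fourierCoef (U' t) := fun t ht => extendSeq_restrictSeq (hU'.fourierCoef_eq_zero ht)
    have h1 := huniq (fun t => restrictSeq N (fourierCoef (U' t))) (by
        unfold restrictSeq
        congr 1
        funext k
        rw [hU'.initial.fourierCoef_eq hf k.2, head_of_mem _ k.2])
      (fun t ht => hasDerivWithinAt_restrictSeq fun k hk => by
        rw [extendSeq_galerkinField_of_symm _ hk, hext t ht]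
        · exact hU'.hasDerivWithinAt ht hk
        · rw [hext t ht]
          exact fourierCoef_neg _) t ht
    change U' t y = (trigPoly N (extendSeq (x t)) y).re
    rw [← h1, hext t ht, ← hU'.eq_trigPoly ht, Complex.ofReal_re]

/-! ### The error bound in L² -/

theorem fourierCoef_congr_ae {f g : ℝ → ℝ} (h : f =ᵐ[MeasureTheory.volume] g) (k : ℤ) :
    fourierCoef f k = fourierCoef g k := by
  unfold fourierCoef
  congr 1
  refine intervalIntegral.integral_congr_ae ?_
  filter_upwards [h] with x hx _
  rw [hx]

theorem l2Norm_sq_eq {N : ℕ} {M : ℝ} {g h : ℝ → ℝ} (hg : MemL2 g) (hh : MemL2 h)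
    (hv : TrigBound N M (fourierCoef h)) (ht : Summable fun k => ‖tail N (fourierCoef g) k‖ ^ 2) :
    l2Norm (fun x => g x - h x) ^ 2 = 2 * Real.pi *
      (errorEnergy N (fourierCoef g) (fourierCoef h) +
        ∑' k, ‖tail N (fourierCoef g) k‖ ^ 2) := by
  have h1 := hasSum_sq_fourierCoef (hg.sub hh)
  simp only [fourierCoef_sub hg hh] at h1
  rw [← h1.unique (hasSum_sq_sub hv ht), l2Norm, Real.sq_sqrt, ← mul_assoc,
    mul_inv_cancel₀ (by positivity), one_mul]
  exact intervalIntegral.integral_nonneg neg_pi_lt_pi.le fun x _ => sq_nonneg _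

/-- The spectral error bound for the Galerkin scheme. -/
theorem exists_l2Norm_sub_le {r : ℕ} (hr : 2 ≤ r) {f : ℝ → ℝ} (hf : MemH r f) {u : ℝ → ℝ → ℝ}
    (hu : IsKawaharaSolution r f u) {T : ℝ} (hT : 0 < T) :
    ∃ C : ℝ, 0 < C ∧ ∀ N : ℕ, 1 ≤ N → ∀ U : ℝ → ℝ → ℝ, IsGalerkinSolution N f U →
      ∀ t ∈ Set.Icc 0 T, l2Norm (fun x => u t x - U t x) ≤ C / (N : ℝ) ^ r := by
  obtain ⟨M, hM, hb⟩ := hu.exists_hNorm_le T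
  set A := embeddingConst M
  set C₀ : ℝ := ((A * M) ^ 2 + 1) * Real.exp (2 * energyConst r A M * T) with hC₀
  have hC₀pos : 0 < C₀ := by positivity
  -- By Parseval the squared error is 2π times the low-frequency energy, at most C₀N^{-2r}, plus the
  -- tail, at most M²N^{-2r}.
  refine ⟨√(2 * Real.pi * (C₀ + M ^ 2)), by positivity, fun N hN U hU t ht => ?_⟩
  have hS : ∀ t ∈ Set.Icc 0 T, SobolevBound r A M (fourierCoef (u t)) := fun t ht =>
    (hu.mem t ht.1).sobolevBound hr (hb t ht)
  have h0 : ∀ k ∈ Finset.Icc (-(N : ℤ)) N, fourierCoef (U 0) k = fourierCoef (u 0) k :=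
    fun k hk => (hU.initial.fourierCoef_eq hf.memL2 hk).trans
      (fourierCoef_congr_ae hu.initial k).symm
  have hV : ∀ t ∈ Set.Icc 0 T, TrigBound N M (fourierCoef (U t)) := fun t ht => by
    refine ⟨fourierCoef_neg _, hU.fourierCoef_eq_zero ht.1, ?_⟩
    have h1 := sum_sq_eq_of_hasDerivWithinAt (v := fun t => fourierCoef (U t))
      (fun t _ => fourierCoef_neg _) (fun t ht => hU.fourierCoef_eq_zero ht)
      (fun t ht k hk => hU.hasDerivWithinAt ht hk) ht.1
    have hS0 := hS 0 ⟨le_rfl, hT.le⟩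
    -- Conservation moves the bound to time 0, where U has the low-frequency coefficients of u(0).
    -- The same M therefore serves for u and U, for every N.
    calc ∑ k ∈ Finset.Icc (-(N : ℤ)) N, ‖fourierCoef (U t) k‖ ^ 2
        = ∑ k ∈ Finset.Icc (-(N : ℤ)) N, ‖fourierCoef (U 0) k‖ ^ 2 := h1
      _ ≤ ∑ k ∈ Finset.Icc (-(N : ℤ)) N,
          (1 + (k : ℝ) ^ 2) ^ r * ‖fourierCoef (u 0) k‖ ^ 2 := by
        refine Finset.sum_le_sum fun k hk => ?_
        rw [h0 k hk]
        exact le_mul_of_one_le_left (sq_nonneg _) (one_le_pow₀ (by nlinarith))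
      _ ≤ M ^ 2 := (hS0.summable_sq.sum_le_tsum _ fun k _ => by positivity).trans hS0.sq_le
  have hE := errorEnergy_le hN hM (u := fun t => fourierCoef (u t))
    (v := fun t => fourierCoef (U t)) hS hV
    (fun t ht k => hu.hasDerivWithinAt hr ht.1 k)
    (fun t ht k hk => hU.hasDerivWithinAt ht.1 hk) h0 ht
  have htail := (hS t ht).tail_sq hN
  have hsq := l2Norm_sq_eq (hu.mem t ht.1).memL2 (memL2_of_mem (hU.mem t ht.1)) (hV t ht) htail.1
  rw [div_eq_mul_inv]
  refine abs_le_of_sq_le_sq' ?_ (by positivity) |>.2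
  have h2 := htail.2
  rw [mul_pow] at h2
  rw [← hC₀] at hE
  have h3 := mul_le_mul_of_nonneg_left (add_le_add hE h2) (by positivity : 0 ≤ 2 * Real.pi)
  rw [hsq, mul_pow, Real.sq_sqrt (by positivity)]
  linarith

end Kawahara

end

theorem mainTheorem1 :
    (∀ N : ℕ, 1 ≤ N → ∀ f : ℝ → ℝ, Kawahara.MemL2 f →
      ∃ U : ℝ → ℝ → ℝ, Kawahara.IsGalerkinSolution N f U ∧
        ∀ U' : ℝ → ℝ → ℝ, Kawahara.IsGalerkinSolution N f U' →
          ∀ t, 0 ≤ t → ∀ x, U' t x = U t x) ∧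
    (∀ r : ℕ, 2 ≤ r → ∀ f : ℝ → ℝ, Kawahara.MemH r f →
      ∀ u : ℝ → ℝ → ℝ, Kawahara.IsKawaharaSolution r f u →
        ∀ T : ℝ, 0 < T → ∃ C : ℝ, 0 < C ∧
          ∀ N : ℕ, 1 ≤ N → ∀ U : ℝ → ℝ → ℝ, Kawahara.IsGalerkinSolution N f U →
            ∀ t ∈ Set.Icc 0 T,
              Kawahara.l2Norm (fun x => u t x - U t x) ≤ C / (N : ℝ) ^ r) :=
  ⟨fun N _ _ hf => Kawahara.exists_unique_isGalerkinSolution N hf,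
    fun _ hr _ hf _ hu _ hT => Kawahara.exists_l2Norm_sub_le hr hf hu hT⟩
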